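/- **Theorem 3.7.** Let $M^*$ be a smooth manifold with an almost contact metric structure $(\phi,\xi,\eta,g)$, i.e. $g$ is a Riemannian metric, $\phi$ a $(1,1)$-tensor field, $\xi$ a vector field and $\eta$ a $1$-form (all smooth) with $\phi^2=-\mathrm{id}+\eta\otimes\xi$, $\phi\xi=0$, $\eta(\xi)=1$, $\eta=g(\cdot,\xi)$, $\eta\circ\phi=0$, $g(\phi X,\phi Y)=g(X,Y)-\eta(X)\eta(Y)$, $g(\phi X,Y)=-g(X,\phi Y)$. Suppose that $M^*$ is an SQ-Sasakian (special quasi-Sasakian) manifold with structure function $\beta$: the structure is normal, i.e. $[\phi X,\phi Y]+\phi^2[X,Y]-\phi[\phi X,Y]-\phi[X,\phi Y]+2d\eta(X,Y)\xi=0$ with $2d\eta(X,Y)=X(\eta(Y))-Y(\eta(X))-\eta([X,Y])$; the fundamental form $\Phi(X,Y)=g(X,\phi Y)$ is closed; and $\bar\nabla_X\xi=-\beta\phi X$ for the Levi-Civita connection $\bar\nabla$ and a smooth function $\beta$ with $\xi\beta=0$. Let $\widetilde{\bar\nabla}_XY=\bar\nabla_XY+\eta(Y)X-g(X,Y)\xi$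 be the semisymmetric metric connection. Let $M$ be an (immersed) invariant submanifold of $M^*$: $\xi$ is tangent to $M$ and $\phi(TM)\subset TM$. Let $h$ be its second fundamental form with respect to $\bar\nabla$, and let $\widetilde\nabla$, $\widetilde h$, $\widetilde\nabla^\perp$ be the connection induced on $M$, the second fundamental form and the normal connection obtained from $\widetilde{\bar\nabla}$ by taking tangential and normal parts. Let $\widetilde R$, $\widetilde R^\perp$ be the curvatures of $\widetilde\nabla$, $\widetilde\nabla^\perp$, and for vector fields $X,Y,Z,U$ on $M$ put $$(\widetilde\nabla_X\widetilde h)(Y,Z)=\widetilde\nabla^\perp_X(\widetilde h(Y,Z))-\widetilde h(\widetilde\nabla_XY,Z)-\widetilde h(Y,\widetilde\nabla_XZ),$$ $$(\widetilde{\bar R}(X,Y)\cdot\widetilde h)(Z,U)=\widetilde R^\perp(X,Y)\widetilde h(Z,U)-\widetilde h(\widetilde R(X,Y)Z,U)-\widetilde h(Z,\widetilde R(X,Y)U),$$ $$Q(g,\widetilde h)(Z,U;X,Y)=g(Y,Z)\widetilde h(X,U)-g(X,Z)\widetilde h(Y,U)+g(Y,U)\widetilde h(X,Z)-g(X,U)\widetilde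 h(Y,Z).$$ Let $\widetilde H=\frac1{\dim M}\operatorname{trace}_g\widetilde h$ be the mean curvature vector and $W=\{x\in M:(\widetilde h-\widetilde H g)_x\ne0\}$. Then the following statements are equivalent: 1. $M$ is totally geodesic, i.e. $h=0$; 2. $M$ is parallel with respect to $\widetilde{\bar\nabla}$, i.e. $\widetilde\nabla\widetilde h=0$; 3. $M$ is semiparallel with respect to $\widetilde{\bar\nabla}$, i.e. $\widetilde{\bar R}(X,Y)\cdot\widetilde h=0$ for all $X,Y$ tangent to $M$, and $\beta^2(\beta^2+1)\neq0$ at every point of $W$; 4. $M$ is Chaki-pseudo parallel with respect to $\widetilde{\bar\nabla}$, i.e. there is a smooth $1$-form $\alpha$ on $M$ with $(\widetilde\nabla_X\widetilde h)(Y,Z)=2\alpha(X)\widetilde h(Y,Z)+\alpha(Y)\widetilde h(X,Z)+\alpha(Z)\widetilde h(X,Y)$ for all $X,Y,Z$, and $(\alpha(\xi)+1)^2+\beta^2\neq0$ everywhere on $M$; 5. the same as 4, with a nowhere vanishing $\alpha$; 6. $M$ is Deszcz-pseudo parallel with respect to $\widetilde{\bar\nabla}$, i.e. there is a function $L_h$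 on $W$ with $\widetilde{\bar R}(X,Y)\cdot\widetilde h=L_hQ(g,\widetilde h)$ on $W$, and $(L_h+\beta^2)^2+\beta^2\neq0$ at every point of $W$. In particular, $M$ is totally geodesic if and only if it is semiparallel with respect to $\widetilde{\bar\nabla}$, provided that $\beta$ has no zero on $M$. -/

import Mathlib

open scoped Manifold ContDiff Bundle
open Bundle VectorField

/-! ## Smooth tensor fields -/

section Fields

variable {E : Type*} [NormedAddCommGroup E] [NormedSpace ℝ E]
  {N : Type*} [TopologicalSpace N] [ChartedSpace E N] [IsManifold 𝓘(ℝ, E) ∞ N]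

/-- A vector field on the manifold `N` is smooth. -/
def IsSmoothField (X : (x : N) → TangentSpace 𝓘(ℝ, E) x) : Prop :=
  ContMDiff 𝓘(ℝ, E) 𝓘(ℝ, E).tangent ∞
    (fun x ↦ (⟨x, X x⟩ : TangentBundle 𝓘(ℝ, E) N))

/-- A field of linear forms on the tangent spaces of `N` is a smooth `1`-form. -/
def IsSmoothOneForm (α : (x : N) → TangentSpace 𝓘(ℝ, E) x →L[ℝ] ℝ) : Prop :=
  ContMDiff 𝓘(ℝ, E) (𝓘(ℝ, E).prod 𝓘(ℝ, E →L[ℝ] ℝ)) ∞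
    (fun x ↦ TotalSpace.mk' (E →L[ℝ] ℝ)
      (E := fun x : N ↦ TangentSpace 𝓘(ℝ, E) x →L[ℝ] Bundle.Trivial N ℝ x) x (α x))

/-- A field of endomorphisms of the tangent spaces of `N` is a smooth `(1,1)`-tensor field. -/
def IsSmoothEndField
    (φ : (x : N) → TangentSpace 𝓘(ℝ, E) x →L[ℝ] TangentSpace 𝓘(ℝ, E) x) : Prop :=
  ContMDiff 𝓘(ℝ, E) (𝓘(ℝ, E).prod 𝓘(ℝ, E →L[ℝ] E)) ∞
    (fun x ↦ TotalSpace.mk' (E →L[ℝ] E)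
      (E := fun x : N ↦ TangentSpace 𝓘(ℝ, E) x →L[ℝ] TangentSpace 𝓘(ℝ, E) x) x (φ x))

end Fields

/-! ## The ambient manifold -/

section Ambient

variable {E : Type*} [NormedAddCommGroup E] [NormedSpace ℝ E] [FiniteDimensional ℝ E]
  {N : Type*} [TopologicalSpace N] [ChartedSpace E N] [IsManifold 𝓘(ℝ, E) ∞ N]
  [RiemannianBundle (fun x : N ↦ TangentSpace 𝓘(ℝ, E) x)]

/-- `cov` is the Levi-Civita connection of the Riemannian metric of `N`: it is torsion-free and
the metric is parallel. (`cov Y x v` is the derivative of the field `Y` at `x` along `v`.) -/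
structure IsLeviCivita [IsContMDiffRiemannianBundle 𝓘(ℝ, E) ∞ E
      (fun x : N ↦ TangentSpace 𝓘(ℝ, E) x)]
    (cov : CovariantDerivative 𝓘(ℝ, E) E (fun x : N ↦ TangentSpace 𝓘(ℝ, E) x)) : Prop where
  torsion_free : cov.torsion = 0
  metric : CovariantDerivative.IsMetricCompatible (V := fun x : N ↦ TangentSpace 𝓘(ℝ, E) x) cov

variable (E N) in
/-- An almost contact metric structure `(φ, ξ, η, g)` on `N`, where `g` is the Riemannian metric
of `N`. -/
structure AlmostContactMetric where
  φ : (x : N) → TangentSpace 𝓘(ℝ, E) x →L[ℝ] TangentSpace 𝓘(ℝ, E) x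
  ξ : (x : N) → TangentSpace 𝓘(ℝ, E) x
  η : (x : N) → TangentSpace 𝓘(ℝ, E) x →L[ℝ] ℝ
  smooth_φ : IsSmoothEndField φ
  smooth_ξ : IsSmoothField ξ
  smooth_η : IsSmoothOneForm η
  φ_φ : ∀ x v, φ x (φ x v) = -v + η x v • ξ x
  φ_ξ : ∀ x, φ x (ξ x) = 0
  η_ξ : ∀ x, η x (ξ x) = 1
  inner_ξ : ∀ x v, inner ℝ v (ξ x) = η x v
  η_φ : ∀ x v, η x (φ x v) = 0
  inner_φ_φ : ∀ x v w, inner ℝ (φ x v) (φ x w) = inner ℝ v w - η x v * η x w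
  inner_φ_left : ∀ x v w, inner ℝ (φ x v) w = -inner ℝ v (φ x w)

namespace AlmostContactMetric

variable (S : AlmostContactMetric E N)

/-- The fundamental `2`-form `Φ(X, Y) = g(X, φ Y)`, evaluated on vector fields. -/
noncomputable def fundForm (X Y : (x : N) → TangentSpace 𝓘(ℝ, E) x) (x : N) : ℝ :=
  inner ℝ (X x) (S.φ x (Y x))

/-- The fundamental `2`-form is closed, `dΦ = 0`, by the invariant formula for the exterior
derivative. -/
def FundFormClosed : Prop :=
  ∀ X Y Z : (x : N) → TangentSpace 𝓘(ℝ, E) x,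
    IsSmoothField X → IsSmoothField Y → IsSmoothField Z → ∀ x,
    mvfderiv 𝓘(ℝ, E) (S.fundForm Y Z) x (X x) + mvfderiv 𝓘(ℝ, E) (S.fundForm Z X) x (Y x)
      + mvfderiv 𝓘(ℝ, E) (S.fundForm X Y) x (Z x)
      - S.fundForm (mlieBracket 𝓘(ℝ, E) X Y) Z x - S.fundForm (mlieBracket 𝓘(ℝ, E) Y Z) X x
      - S.fundForm (mlieBracket 𝓘(ℝ, E) Z X) Y x = 0

/-- The function `2 dη(X, Y) = X(η(Y)) - Y(η(X)) - η([X, Y])`. -/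
noncomputable def twoDη (X Y : (x : N) → TangentSpace 𝓘(ℝ, E) x) (x : N) : ℝ :=
  mvfderiv 𝓘(ℝ, E) (fun y ↦ S.η y (Y y)) x (X x)
    - mvfderiv 𝓘(ℝ, E) (fun y ↦ S.η y (X y)) x (Y x)
    - S.η x (mlieBracket 𝓘(ℝ, E) X Y x)

/-- The structure is normal:
`[φX, φY] + φ²[X, Y] - φ[φX, Y] - φ[X, φY] + 2 dη(X, Y) ξ = 0`. -/
def Normal : Prop :=
  ∀ X Y : (x : N) → TangentSpace 𝓘(ℝ, E) x, IsSmoothField X → IsSmoothField Y → ∀ x,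
    mlieBracket 𝓘(ℝ, E) (fun y ↦ S.φ y (X y)) (fun y ↦ S.φ y (Y y)) x
      + S.φ x (S.φ x (mlieBracket 𝓘(ℝ, E) X Y x))
      - S.φ x (mlieBracket 𝓘(ℝ, E) (fun y ↦ S.φ y (X y)) Y x)
      - S.φ x (mlieBracket 𝓘(ℝ, E) X (fun y ↦ S.φ y (Y y)) x)
      + S.twoDη X Y x • S.ξ x = 0

/-- `N` is a special quasi-Sasakian manifold with structure function `β`; here `cov` is its
Levi-Civita connection. -/
structure IsSQSasakian
    (cov : CovariantDerivative 𝓘(ℝ, E) E (fun x : N ↦ TangentSpace 𝓘(ℝ, E) x))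
    (β : N → ℝ) : Prop where
  smooth_β : ContMDiff 𝓘(ℝ, E) 𝓘(ℝ, ℝ) ∞ β
  ξ_β : ∀ x, mvfderiv 𝓘(ℝ, E) β x (S.ξ x) = 0
  normal : S.Normal
  closed : S.FundFormClosed
  cov_ξ : ∀ x v, cov S.ξ x v = -(β x • S.φ x v)

/-- The semisymmetric metric connection
`∇̃_X Y = ∇_X Y + η(Y) X - g(X, Y) ξ` attached to the Levi-Civita connection `∇ = cov`. -/
noncomputable def semisymmetric
    (cov : CovariantDerivative 𝓘(ℝ, E) E (fun x : N ↦ TangentSpace 𝓘(ℝ, E) x)) :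
    CovariantDerivative 𝓘(ℝ, E) E (fun x : N ↦ TangentSpace 𝓘(ℝ, E) x) where
  toFun Y x := cov Y x + S.η x (Y x) • ContinuousLinearMap.id ℝ (TangentSpace 𝓘(ℝ, E) x)
    - (innerSL ℝ (Y x)).smulRight (S.ξ x)
  isCovariantDerivativeOnUniv :=
    { add := by
        intro σ σ' x hσ hσ' _
        ext v
        simp [cov.isCovariantDerivativeOn.add hσ hσ']
        module
      leibniz := by
        intro σ g x hσ hg _
        ext v
        simp [cov.isCovariantDerivativeOn.leibniz hσ hg]
        module }

end AlmostContactMetric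

end Ambient

/-! ## Immersed submanifolds -/

section Submanifold

variable (E F N M : Type*) [NormedAddCommGroup E] [NormedSpace ℝ E]
  [NormedAddCommGroup F] [NormedSpace ℝ F]
  [TopologicalSpace N] [ChartedSpace E N] [TopologicalSpace M] [ChartedSpace F M]

/-- An immersed submanifold of `N`: a manifold `M` with a smooth immersion `ι : M → N`. -/
structure ImmersedSubmanifold where
  ι : M → N
  smooth : ContMDiff 𝓘(ℝ, F) 𝓘(ℝ, E) ∞ ι
  immersive : ∀ p, Function.Injective (mfderiv 𝓘(ℝ, F) 𝓘(ℝ, E) ι p)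

end Submanifold

namespace ImmersedSubmanifold

variable {E F N M : Type*} [NormedAddCommGroup E] [NormedSpace ℝ E] [FiniteDimensional ℝ E]
  [NormedAddCommGroup F] [NormedSpace ℝ F] [FiniteDimensional ℝ F]
  [TopologicalSpace N] [ChartedSpace E N] [IsManifold 𝓘(ℝ, E) ∞ N]
  [RiemannianBundle (fun x : N ↦ TangentSpace 𝓘(ℝ, E) x)]
  [TopologicalSpace M] [ChartedSpace F M] [IsManifold 𝓘(ℝ, F) ∞ M]
  (f : ImmersedSubmanifold E F N M)

/-- The differential of the immersion at `p`. -/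
noncomputable def diff (p : M) : TangentSpace 𝓘(ℝ, F) p →L[ℝ] TangentSpace 𝓘(ℝ, E) (f.ι p) :=
  mfderiv 𝓘(ℝ, F) 𝓘(ℝ, E) f.ι p

/-- A vector field on `M`, regarded as a vector field of `N` along the immersion. -/
noncomputable def push (X : (p : M) → TangentSpace 𝓘(ℝ, F) p) (p : M) :
    TangentSpace 𝓘(ℝ, E) (f.ι p) :=
  f.diff p (X p)

/-- The tangent space of the submanifold at `p`, as a subspace of the tangent space of `N`. -/
noncomputable def tangentSubspace (p : M) : Submodule ℝ (TangentSpace 𝓘(ℝ, E) (f.ι p)) :=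
  LinearMap.range (f.diff p).toLinearMap

instance finiteDimensional_tangentSubspace (p : M) :
    FiniteDimensional ℝ (f.tangentSubspace p) :=
  haveI : FiniteDimensional ℝ (TangentSpace 𝓘(ℝ, E) (f.ι p)) :=
    inferInstanceAs (FiniteDimensional ℝ E)
  FiniteDimensional.finiteDimensional_submodule _

/-- The tangential part of a tangent vector of `N` at a point of the submanifold, as a tangent
vector of `M`: the preimage under the differential of the orthogonal projection. -/
noncomputable def tangentialPart (p : M) (w : TangentSpace 𝓘(ℝ, E) (f.ι p)) :
    TangentSpace 𝓘(ℝ, F) p :=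
  (LinearEquiv.ofInjective (f.diff p).toLinearMap (f.immersive p)).symm
    ((f.tangentSubspace p).orthogonalProjectionOnto w)

/-- The component of a tangent vector of `N` normal to the submanifold. -/
noncomputable def normalPart (p : M) (w : TangentSpace 𝓘(ℝ, E) (f.ι p)) :
    TangentSpace 𝓘(ℝ, E) (f.ι p) :=
  w - f.diff p (f.tangentialPart p w)

/-- The covariant derivative at `p`, in the direction `v`, of a vector field `V` of `N` along the
immersion, for a connection `cov` of `N` (that is, the pullback connection). In the frame
`e` of the preferred trivialization around `f.ι p` write `V = ∑ Vⁱ eᵢ`; then the value is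
`∑ Vⁱ(p) ∇_{dι(v)} eᵢ + ∑ dVⁱ(v) eᵢ`. -/
noncomputable def covAlong
    (cov : CovariantDerivative 𝓘(ℝ, E) E (fun x : N ↦ TangentSpace 𝓘(ℝ, E) x))
    (V : (p : M) → TangentSpace 𝓘(ℝ, E) (f.ι p)) (p : M) (v : TangentSpace 𝓘(ℝ, F) p) :
    TangentSpace 𝓘(ℝ, E) (f.ι p) :=
  cov (FiberBundle.extend E (V p)) (f.ι p) (f.diff p v)
    + (trivializationAt E (fun x : N ↦ TangentSpace 𝓘(ℝ, E) x) (f.ι p)).symm (f.ι p)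
        (mvfderiv 𝓘(ℝ, F)
          (fun q ↦ (trivializationAt E (fun x : N ↦ TangentSpace 𝓘(ℝ, E) x) (f.ι p)
            ⟨f.ι q, V q⟩).2) p v)

section Connection

/-! In this section `cov` is any connection of the ambient manifold `N`; the objects below are those
which it induces on the submanifold through the Gauss and Weingarten decompositions. -/

variable (cov : CovariantDerivative 𝓘(ℝ, E) E (fun x : N ↦ TangentSpace 𝓘(ℝ, E) x))

/-- The induced connection `∇_X Y` of `M`: the tangential part of the ambient derivative. -/
noncomputable def inducedCov (X Y : (p : M) → TangentSpace 𝓘(ℝ, F) p) (p : M) :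
    TangentSpace 𝓘(ℝ, F) p :=
  f.tangentialPart p (f.covAlong cov (f.push Y) p (X p))

/-- The normal connection `∇^⊥_X V`: the normal part of the ambient derivative. -/
noncomputable def normalCov (X : (p : M) → TangentSpace 𝓘(ℝ, F) p)
    (V : (p : M) → TangentSpace 𝓘(ℝ, E) (f.ι p)) (p : M) : TangentSpace 𝓘(ℝ, E) (f.ι p) :=
  f.normalPart p (f.covAlong cov V p (X p))

/-- The second fundamental form `h_p(v, w)`: the normal part of the ambient derivative, in the
direction `v`, of a local field tangent to `M` with value `w` at `p` (it does not depend on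
the choice of this extension of `w`). -/
noncomputable def secondForm (p : M) (v w : TangentSpace 𝓘(ℝ, F) p) :
    TangentSpace 𝓘(ℝ, E) (f.ι p) :=
  f.normalPart p (f.covAlong cov
    (f.push (FiberBundle.extend F (E := fun q : M ↦ TangentSpace 𝓘(ℝ, F) q) w)) p v)

/-- The covariant derivative of the second fundamental form:
`(∇_X h)(Y, Z) = ∇^⊥_X (h(Y, Z)) - h(∇_X Y, Z) - h(Y, ∇_X Z)`. -/
noncomputable def covSecondForm (X Y Z : (p : M) → TangentSpace 𝓘(ℝ, F) p) (p : M) :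
    TangentSpace 𝓘(ℝ, E) (f.ι p) :=
  f.normalCov cov X (fun q ↦ f.secondForm cov q (Y q) (Z q)) p
    - f.secondForm cov p (f.inducedCov cov X Y p) (Z p)
    - f.secondForm cov p (Y p) (f.inducedCov cov X Z p)

/-- The curvature `R(X, Y) Z` of the induced connection. -/
noncomputable def curvature (X Y Z : (p : M) → TangentSpace 𝓘(ℝ, F) p) (p : M) :
    TangentSpace 𝓘(ℝ, F) p :=
  f.inducedCov cov X (f.inducedCov cov Y Z) p - f.inducedCov cov Y (f.inducedCov cov X Z) p
    - f.inducedCov cov (mlieBracket 𝓘(ℝ, F) X Y) Z p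

/-- The curvature `R^⊥(X, Y) V` of the normal connection. -/
noncomputable def normalCurvature (X Y : (p : M) → TangentSpace 𝓘(ℝ, F) p)
    (V : (p : M) → TangentSpace 𝓘(ℝ, E) (f.ι p)) (p : M) : TangentSpace 𝓘(ℝ, E) (f.ι p) :=
  f.normalCov cov X (f.normalCov cov Y V) p - f.normalCov cov Y (f.normalCov cov X V) p
    - f.normalCov cov (mlieBracket 𝓘(ℝ, F) X Y) V p

/-- `(R(X, Y) · h)(Z, U) = R^⊥(X, Y) h(Z, U) - h(R(X, Y) Z, U) - h(Z, R(X, Y) U)`. -/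
noncomputable def curvatureDotSecondForm (X Y Z U : (p : M) → TangentSpace 𝓘(ℝ, F) p) (p : M) :
    TangentSpace 𝓘(ℝ, E) (f.ι p) :=
  f.normalCurvature cov X Y (fun q ↦ f.secondForm cov q (Z q) (U q)) p
    - f.secondForm cov p (f.curvature cov X Y Z p) (U p)
    - f.secondForm cov p (Z p) (f.curvature cov X Y U p)

/-- The induced metric `g` of `M`. -/
noncomputable def metric (p : M) (v w : TangentSpace 𝓘(ℝ, F) p) : ℝ :=
  inner ℝ (f.diff p v) (f.diff p w)

/-- `Q(g, h)(Z, U; X, Y) = g(Y,Z) h(X,U) - g(X,Z) h(Y,U) + g(Y,U) h(X,Z) - g(X,U) h(Y,Z)`. -/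
noncomputable def tachibana (X Y Z U : (p : M) → TangentSpace 𝓘(ℝ, F) p) (p : M) :
    TangentSpace 𝓘(ℝ, E) (f.ι p) :=
  f.metric p (Y p) (Z p) • f.secondForm cov p (X p) (U p)
    - f.metric p (X p) (Z p) • f.secondForm cov p (Y p) (U p)
    + f.metric p (Y p) (U p) • f.secondForm cov p (X p) (Z p)
    - f.metric p (X p) (U p) • f.secondForm cov p (Y p) (Z p)

/-- The mean curvature vector `H = (1 / dim M) ∑ h(eᵢ, eᵢ)`, for an orthonormal basis `e` of the
tangent space of the submanifold. -/
noncomputable def meanCurvature (p : M) : TangentSpace 𝓘(ℝ, E) (f.ι p) :=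
  (Module.finrank ℝ F : ℝ)⁻¹ •
    ∑ i, f.secondForm cov p
      (f.tangentialPart p (stdOrthonormalBasis ℝ (f.tangentSubspace p) i))
      (f.tangentialPart p (stdOrthonormalBasis ℝ (f.tangentSubspace p) i))

/-- The set `W` of the points of `M` at which `h - H g ≠ 0`. -/
def nonUmbilical : Set M :=
  {p | ¬ ∀ v w : TangentSpace 𝓘(ℝ, F) p,
    f.secondForm cov p v w - f.metric p v w • f.meanCurvature cov p = 0}

/-- The second fundamental form vanishes identically. -/
def TotallyGeodesic : Prop :=
  ∀ (p : M) (v w : TangentSpace 𝓘(ℝ, F) p), f.secondForm cov p v w = 0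

/-- The second fundamental form is parallel. -/
def Parallel : Prop :=
  ∀ X Y Z : (p : M) → TangentSpace 𝓘(ℝ, F) p,
    IsSmoothField X → IsSmoothField Y → IsSmoothField Z → ∀ p, f.covSecondForm cov X Y Z p = 0

/-- The second fundamental form is semiparallel. -/
def Semiparallel : Prop :=
  ∀ X Y Z U : (p : M) → TangentSpace 𝓘(ℝ, F) p,
    IsSmoothField X → IsSmoothField Y → IsSmoothField Z → IsSmoothField U →
    ∀ p, f.curvatureDotSecondForm cov X Y Z U p = 0

/-- `M` is Chaki-pseudo parallel with associated `1`-form `α`. -/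
def ChakiPseudoParallel (α : (p : M) → TangentSpace 𝓘(ℝ, F) p →L[ℝ] ℝ) : Prop :=
  ∀ X Y Z : (p : M) → TangentSpace 𝓘(ℝ, F) p,
    IsSmoothField X → IsSmoothField Y → IsSmoothField Z → ∀ p,
    f.covSecondForm cov X Y Z p =
      (2 * α p (X p)) • f.secondForm cov p (Y p) (Z p)
        + α p (Y p) • f.secondForm cov p (X p) (Z p)
        + α p (Z p) • f.secondForm cov p (X p) (Y p)

/-- `M` is Deszcz-pseudo parallel with associated function `L`; only the values of `L` on the set
`nonUmbilical` matter, and the defining identity is required there. -/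
def DeszczPseudoParallel (L : M → ℝ) : Prop :=
  ∀ X Y Z U : (p : M) → TangentSpace 𝓘(ℝ, F) p,
    IsSmoothField X → IsSmoothField Y → IsSmoothField Z → IsSmoothField U →
    ∀ p ∈ f.nonUmbilical cov,
      f.curvatureDotSecondForm cov X Y Z U p = L p • f.tachibana cov X Y Z U p

end Connection

/-- The submanifold is invariant: `ξ` is tangent to it, and `φ` preserves its tangent spaces. -/
def Invariant (S : AlmostContactMetric E N) : Prop :=
  ∀ p, S.ξ (f.ι p) ∈ f.tangentSubspace p ∧
    ∀ w ∈ f.tangentSubspace p, S.φ (f.ι p) w ∈ f.tangentSubspace p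

/-- The structure vector field `ξ` of `N` as a vector field of `M`, for `ξ` tangent to `M`. -/
noncomputable def ξTangent (S : AlmostContactMetric E N) (p : M) : TangentSpace 𝓘(ℝ, F) p :=
  f.tangentialPart p (S.ξ (f.ι p))

end ImmersedSubmanifold

set_option linter.unusedSectionVars false

/-! The whole argument takes place in the `ξ` slot. Since `∇_X ξ = -β φX` and an invariant
submanifold has `ξ` and `φ(TM)` tangent to it, `h(X, ξ) = 0`. The terms added by the semisymmetric
connection are tangent as well, so `h̃ = h`. Moreover `φ² = -id` modulo `ξ`, hence `h(v, φ²w) =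
-h(v, w)`. Consequently an identity `a h(v, w) = b h(v, φw)`, valid for all `w`, can be applied
twice and yields `(a² + b²) h(v, ·) = 0`: this is `secondForm_eq_zero_of_φTangent`, and the
non-degeneracy assumptions in the theorem say exactly that `a² + b² ≠ 0`.

Each parallelism condition yields such an identity when evaluated on `ξ`. From `∇̃_X ξ = X - β φX -
η(X) ξ` one gets `(∇̃_X h)(Y, ξ) = β h(Y, φX) - h(Y, X)`, so the Chaki condition gives `(α(ξ) + 1)
h(Y, X) = β h(Y, φX)`; the parallel case is `α = 0`. For the curvature conditions, `R̃(X, ξ)ξ = β φX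
+ β² X` modulo `ξ`, so the Deszcz condition gives `(L + β²) h(Z, X) = -β h(Z, φX)`; the semiparallel
case is `L = 0`. The curvature formula rests on `ξβ = 0` and on `∇_ξ φ = 0` modulo `ξ`, which
follows from normality. Outside `W` the form is umbilical, and `h(ξ, ξ) = 0` with `|ξ| = 1` forces
`H = 0`, hence `h = 0`.

Conversely, `h = 0` makes every tensor involved vanish and `W` empty. The remaining work is to
justify calculus with fields along an immersion: product and chain rules, vanishing torsion of the
pullback connection, and smoothness of `ξ` as a field of `M`. -/

section Preliminaries

open scoped Topology

/-! ### Vector fields along a map, in bundle coordinates -/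

section Coordinates

variable {E F N M : Type*} [NormedAddCommGroup E] [NormedSpace ℝ E]
  [NormedAddCommGroup F] [NormedSpace ℝ F]
  [TopologicalSpace N] [ChartedSpace E N] [IsManifold 𝓘(ℝ, E) ∞ N]
  [TopologicalSpace M] [ChartedSpace F M]

lemma mvfderiv_congr_of_eventuallyEq {g g' : M → E} {p : M} (h : g =ᶠ[𝓝 p] g') :
    mvfderiv 𝓘(ℝ, F) g p = mvfderiv 𝓘(ℝ, F) g' p := by
  ext v
  simp only [mvfderiv, h.mfderiv_eq]
  rfl

/-- The coordinates, in the preferred trivialization of the tangent bundle around `x`, of a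
tangent vector at a nearby point `y`. -/
noncomputable def tangentCoord (x : N) {y : N} (w : TangentSpace 𝓘(ℝ, E) y) : E :=
  (trivializationAt E (fun x : N ↦ TangentSpace 𝓘(ℝ, E) x) x ⟨y, w⟩).2

/-- The tangent vector at `y` with given coordinates in the preferred trivialization around `x`. -/
noncomputable def tangentOfCoord (x y : N) : E →L[ℝ] TangentSpace 𝓘(ℝ, E) y :=
  (trivializationAt E (fun x : N ↦ TangentSpace 𝓘(ℝ, E) x) x).symmL ℝ y

variable (E) in
/-- The domain of the preferred trivialization of the tangent bundle around `x`. -/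
def tangentCoordDomain (x : N) : Set N :=
  (trivializationAt E (fun x : N ↦ TangentSpace 𝓘(ℝ, E) x) x).baseSet

lemma tangentCoordDomain_mem_nhds (x : N) : tangentCoordDomain E x ∈ 𝓝 x :=
  (trivializationAt E (fun x : N ↦ TangentSpace 𝓘(ℝ, E) x) x).open_baseSet.mem_nhds
    (FiberBundle.mem_baseSet_trivializationAt' x)

lemma mem_tangentCoordDomain (x : N) : x ∈ tangentCoordDomain E x :=
  mem_of_mem_nhds (tangentCoordDomain_mem_nhds x)

lemma tangentCoord_eq (x : N) {y : N} (hy : y ∈ tangentCoordDomain E x)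
    (w : TangentSpace 𝓘(ℝ, E) y) :
    tangentCoord x w =
      (trivializationAt E (fun x : N ↦ TangentSpace 𝓘(ℝ, E) x) x).continuousLinearMapAt ℝ y w := by
  rw [Trivialization.continuousLinearMapAt_apply, Trivialization.coe_linearMapAt_of_mem _ hy]
  rfl

lemma tangentCoord_add (x : N) {y : N} (hy : y ∈ tangentCoordDomain E x)
    (v w : TangentSpace 𝓘(ℝ, E) y) :
    tangentCoord x (v + w) = tangentCoord x v + tangentCoord x w := by
  simp only [tangentCoord_eq x hy, map_add]

lemma tangentCoord_smul (x : N) {y : N} (hy : y ∈ tangentCoordDomain E x) (c : ℝ)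
    (w : TangentSpace 𝓘(ℝ, E) y) : tangentCoord x (c • w) = c • tangentCoord x w := by
  simp only [tangentCoord_eq x hy, map_smul]

lemma tangentOfCoord_apply (x : N) {y : N} (hy : y ∈ tangentCoordDomain E x) (u : E) :
    tangentOfCoord x y u =
      (trivializationAt E (fun x : N ↦ TangentSpace 𝓘(ℝ, E) x) x).symm y u :=
  Trivialization.symmL_apply (R := ℝ)
    (trivializationAt E (fun x : N ↦ TangentSpace 𝓘(ℝ, E) x) x) hy u

lemma tangentOfCoord_tangentCoord (x : N) {y : N} (hy : y ∈ tangentCoordDomain E x)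
    (w : TangentSpace 𝓘(ℝ, E) y) : tangentOfCoord x y (tangentCoord x w) = w := by
  rw [tangentOfCoord_apply x hy]
  exact (trivializationAt E (fun x : N ↦ TangentSpace 𝓘(ℝ, E) x) x).symm_apply_apply_mk hy w

lemma tangentCoord_tangentOfCoord (x : N) {y : N} (hy : y ∈ tangentCoordDomain E x) (u : E) :
    tangentCoord x (tangentOfCoord x y u) = u := by
  rw [tangentOfCoord_apply x hy]
  exact congrArg Prod.snd
    ((trivializationAt E (fun x : N ↦ TangentSpace 𝓘(ℝ, E) x) x).apply_mk_symm hy u)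

lemma extend_eq_tangentOfCoord (x : N) (w : TangentSpace 𝓘(ℝ, E) x) {y : N}
    (hy : y ∈ tangentCoordDomain E x) :
    FiberBundle.extend E (E := fun x : N ↦ TangentSpace 𝓘(ℝ, E) x) w y =
      tangentOfCoord x y (tangentCoord x w) := by
  rw [tangentOfCoord_apply x hy]
  rfl

lemma tangentCoord_extend (x : N) (w : TangentSpace 𝓘(ℝ, E) x) {y : N}
    (hy : y ∈ tangentCoordDomain E x) :
    tangentCoord x
      (FiberBundle.extend E (E := fun x : N ↦ TangentSpace 𝓘(ℝ, E) x) w y) = tangentCoord x w := by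
  rw [extend_eq_tangentOfCoord x w hy, tangentCoord_tangentOfCoord x hy]

variable (F) in
/-- Differentiability at `p` of a field of tangent vectors along the map `b`. -/
def DiffAlong (b : M → N) (V : (p : M) → TangentSpace 𝓘(ℝ, E) (b p)) (p : M) : Prop :=
  MDifferentiableAt 𝓘(ℝ, F) 𝓘(ℝ, E).tangent (fun q ↦ (⟨b q, V q⟩ : TangentBundle 𝓘(ℝ, E) N)) p

variable {b : M → N} {V W : (p : M) → TangentSpace 𝓘(ℝ, E) (b p)} {p : M}

lemma diffAlong_iff : DiffAlong F b V p ↔ MDifferentiableAt 𝓘(ℝ, F) 𝓘(ℝ, E) b p ∧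
    MDifferentiableAt 𝓘(ℝ, F) 𝓘(ℝ, E) (fun q ↦ tangentCoord (b p) (V q)) p :=
  mdifferentiableAt_totalSpace 𝓘(ℝ, E) _

lemma DiffAlong.base (h : DiffAlong F b V p) : MDifferentiableAt 𝓘(ℝ, F) 𝓘(ℝ, E) b p :=
  (diffAlong_iff.1 h).1

lemma DiffAlong.coord (h : DiffAlong F b V p) :
    MDifferentiableAt 𝓘(ℝ, F) 𝓘(ℝ, E) (fun q ↦ tangentCoord (b p) (V q)) p :=
  (diffAlong_iff.1 h).2

lemma eventually_mem_tangentCoordDomain (hb : MDifferentiableAt 𝓘(ℝ, F) 𝓘(ℝ, E) b p) :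
    ∀ᶠ q in 𝓝 p, b q ∈ tangentCoordDomain E (b p) :=
  hb.continuousAt (tangentCoordDomain_mem_nhds (b p))

lemma DiffAlong.tangentCoord_add (hV : DiffAlong F b V p) :
    (fun q ↦ tangentCoord (b p) (V q + W q)) =ᶠ[𝓝 p]
      fun q ↦ tangentCoord (b p) (V q) + tangentCoord (b p) (W q) := by
  filter_upwards [eventually_mem_tangentCoordDomain hV.base] with q hq
  exact _root_.tangentCoord_add _ hq _ _

lemma DiffAlong.tangentCoord_smul (hV : DiffAlong F b V p) (g : M → ℝ) :
    (fun q ↦ tangentCoord (b p) (g q • V q)) =ᶠ[𝓝 p]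
      fun q ↦ g q • tangentCoord (b p) (V q) := by
  filter_upwards [eventually_mem_tangentCoordDomain hV.base] with q hq
  exact _root_.tangentCoord_smul _ hq _ _

lemma DiffAlong.mvfderiv_add (hV : DiffAlong F b V p) (hW : DiffAlong F b W p) :
    mvfderiv 𝓘(ℝ, F) (fun q ↦ tangentCoord (b p) (V q + W q)) p =
      mvfderiv 𝓘(ℝ, F) (fun q ↦ tangentCoord (b p) (V q)) p +
        mvfderiv 𝓘(ℝ, F) (fun q ↦ tangentCoord (b p) (W q)) p := by
  rw [mvfderiv_congr_of_eventuallyEq hV.tangentCoord_add]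
  exact _root_.mvfderiv_add hV.coord hW.coord

lemma DiffAlong.mvfderiv_smul {g : M → ℝ} (hg : MDifferentiableAt 𝓘(ℝ, F) 𝓘(ℝ, ℝ) g p)
    (hV : DiffAlong F b V p) :
    mvfderiv 𝓘(ℝ, F) (fun q ↦ tangentCoord (b p) (g q • V q)) p =
      g p • mvfderiv 𝓘(ℝ, F) (fun q ↦ tangentCoord (b p) (V q)) p +
        (mvfderiv 𝓘(ℝ, F) g p).smulRight (tangentCoord (b p) (V p)) := by
  rw [mvfderiv_congr_of_eventuallyEq (hV.tangentCoord_smul g)]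
  exact _root_.mvfderiv_smul hg hV.coord

lemma DiffAlong.add (hV : DiffAlong F b V p) (hW : DiffAlong F b W p) :
    DiffAlong F b (fun q ↦ V q + W q) p :=
  diffAlong_iff.2 ⟨hV.base, (hV.coord.add hW.coord).congr_of_eventuallyEq hV.tangentCoord_add⟩

lemma DiffAlong.smul {g : M → ℝ} (hg : MDifferentiableAt 𝓘(ℝ, F) 𝓘(ℝ, ℝ) g p)
    (hV : DiffAlong F b V p) : DiffAlong F b (fun q ↦ g q • V q) p :=
  diffAlong_iff.2 ⟨hV.base, (hg.smul hV.coord).congr_of_eventuallyEq (hV.tangentCoord_smul g)⟩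

lemma DiffAlong.comp {Z : (x : N) → TangentSpace 𝓘(ℝ, E) x}
    (hZ : MDifferentiableAt 𝓘(ℝ, E) 𝓘(ℝ, E).tangent
      (fun x ↦ (⟨x, Z x⟩ : TangentBundle 𝓘(ℝ, E) N)) (b p))
    (hb : MDifferentiableAt 𝓘(ℝ, F) 𝓘(ℝ, E) b p) : DiffAlong F b (fun q ↦ Z (b q)) p :=
  hZ.comp p hb

end Coordinates

section Extend

variable {E N : Type*} [NormedAddCommGroup E] [NormedSpace ℝ E]
  [TopologicalSpace N] [ChartedSpace E N] [IsManifold 𝓘(ℝ, E) ∞ N]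

lemma diffAlong_extend {x : N} (w : TangentSpace 𝓘(ℝ, E) x) :
    DiffAlong E (fun y : N ↦ y)
      (FiberBundle.extend E (E := fun x : N ↦ TangentSpace 𝓘(ℝ, E) x) w) x :=
  FiberBundle.mdifferentiableAt_extend 𝓘(ℝ, E) E (V := fun x : N ↦ TangentSpace 𝓘(ℝ, E) x) w

/-- The canonical extension has constant coordinates, so it plays the role of a coordinate frame
field. -/
lemma mvfderiv_tangentCoord_extend {x : N} (w : TangentSpace 𝓘(ℝ, E) x) :
    mvfderiv 𝓘(ℝ, E) (fun y ↦ tangentCoord x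
      (FiberBundle.extend E (E := fun x : N ↦ TangentSpace 𝓘(ℝ, E) x) w y)) x = 0 := by
  have h : (fun y ↦ tangentCoord x
      (FiberBundle.extend E (E := fun x : N ↦ TangentSpace 𝓘(ℝ, E) x) w y)) =ᶠ[𝓝 x]
      fun _ ↦ tangentCoord x w := by
    filter_upwards [tangentCoordDomain_mem_nhds (E := E) x] with y hy
    exact tangentCoord_extend x w hy
  rw [mvfderiv_congr_of_eventuallyEq h, mvfderiv_const]

lemma extend_add_eventuallyEq {x : N} (v w : TangentSpace 𝓘(ℝ, E) x) :
    ∀ᶠ y in 𝓝 x, FiberBundle.extend E (E := fun x : N ↦ TangentSpace 𝓘(ℝ, E) x) (v + w) y =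
      (FiberBundle.extend E (E := fun x : N ↦ TangentSpace 𝓘(ℝ, E) x) v +
        FiberBundle.extend E (E := fun x : N ↦ TangentSpace 𝓘(ℝ, E) x) w) y := by
  filter_upwards [tangentCoordDomain_mem_nhds (E := E) x] with y hy
  rw [Pi.add_apply]
  simp only [extend_eq_tangentOfCoord x _ hy, tangentCoord_add x (mem_tangentCoordDomain x),
    map_add]

lemma extend_smul_eventuallyEq {x : N} (c : ℝ) (w : TangentSpace 𝓘(ℝ, E) x) :
    ∀ᶠ y in 𝓝 x, FiberBundle.extend E (E := fun x : N ↦ TangentSpace 𝓘(ℝ, E) x) (c • w) y =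
      (c • FiberBundle.extend E (E := fun x : N ↦ TangentSpace 𝓘(ℝ, E) x) w) y := by
  filter_upwards [tangentCoordDomain_mem_nhds (E := E) x] with y hy
  rw [Pi.smul_apply]
  simp only [extend_eq_tangentOfCoord x _ hy, tangentCoord_smul x (mem_tangentCoordDomain x),
    map_smul]

end Extend

/-! ### Connections in coordinates -/

section Connection

variable {E N : Type*} [NormedAddCommGroup E] [NormedSpace ℝ E]
  [TopologicalSpace N] [ChartedSpace E N] [IsManifold 𝓘(ℝ, E) ∞ N]
  (cov : CovariantDerivative 𝓘(ℝ, E) E (fun x : N ↦ TangentSpace 𝓘(ℝ, E) x))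

lemma CovariantDerivative.extend_add {x : N} (v w : TangentSpace 𝓘(ℝ, E) x) :
    cov (FiberBundle.extend E (v + w)) x
      = cov (FiberBundle.extend E v) x + cov (FiberBundle.extend E w) x := by
  have hv := diffAlong_extend v
  have hw := diffAlong_extend w
  rw [← cov.isCovariantDerivativeOn.add hv hw]
  exact cov.isCovariantDerivativeOn.congr_of_eventuallyEq (diffAlong_extend (v + w))
    (hv.add hw) Filter.univ_mem (extend_add_eventuallyEq v w)

lemma CovariantDerivative.extend_smul {x : N} (c : ℝ) (w : TangentSpace 𝓘(ℝ, E) x) :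
    cov (FiberBundle.extend E (c • w)) x = c • cov (FiberBundle.extend E w) x := by
  have hw := diffAlong_extend w
  rw [← cov.isCovariantDerivativeOn.smul_const c hw]
  exact cov.isCovariantDerivativeOn.congr_of_eventuallyEq (diffAlong_extend (c • w))
    (hw.smul mdifferentiableAt_const) Filter.univ_mem (extend_smul_eventuallyEq c w)

variable [FiniteDimensional ℝ E]

/-- A connection, in coordinates, differs from the flat connection by a tensor. -/
lemma CovariantDerivative.eq_extend_add {Z : (x : N) → TangentSpace 𝓘(ℝ, E) x} {x : N}
    (hZ : DiffAlong E (fun y : N ↦ y) Z x) (u : TangentSpace 𝓘(ℝ, E) x) :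
    cov Z x u = cov (FiberBundle.extend E (Z x)) x u
      + tangentOfCoord x x (mvfderiv 𝓘(ℝ, E) (fun y ↦ tangentCoord x (Z y)) x u) := by
  -- The derivative terms of the two Leibniz rules cancel in this difference, so it depends only on
  -- `Z x` and may be computed on the extension of `Z x`, whose flat derivative is zero.
  let Φ : ((x : N) → TangentSpace 𝓘(ℝ, E) x) → TangentSpace 𝓘(ℝ, E) x := fun Z ↦
    cov Z x u - tangentOfCoord x x (mvfderiv 𝓘(ℝ, E) (fun y ↦ tangentCoord x (Z y)) x u)
  have hΦ : TensorialAt 𝓘(ℝ, E) E (V := fun x : N ↦ TangentSpace 𝓘(ℝ, E) x) Φ x := by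
    refine ⟨fun {g σ} hg hσ ↦ ?_, fun {σ τ} hσ hτ ↦ ?_⟩
    · have hσ' : DiffAlong E (fun y : N ↦ y) σ x := hσ
      have h : mvfderiv 𝓘(ℝ, E) (fun y ↦ tangentCoord x ((g • σ) y)) x =
          g x • mvfderiv 𝓘(ℝ, E) (fun y ↦ tangentCoord x (σ y)) x +
            (mvfderiv 𝓘(ℝ, E) g x).smulRight (tangentCoord x (σ x)) :=
        hσ'.mvfderiv_smul (b := fun y : N ↦ y) hg
      have e : tangentOfCoord x x (tangentCoord x (σ x)) = σ x :=
        tangentOfCoord_tangentCoord x (mem_tangentCoordDomain x) _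
      simp only [Φ, cov.isCovariantDerivativeOn.leibniz hσ hg, h, add_apply, smul_apply,
        ContinuousLinearMap.smulRight_apply, map_add, map_smul, e]
      rw [smul_sub]
      abel
    · have hσ' : DiffAlong E (fun y : N ↦ y) σ x := hσ
      have h : mvfderiv 𝓘(ℝ, E) (fun y ↦ tangentCoord x ((σ + τ) y)) x =
          mvfderiv 𝓘(ℝ, E) (fun y ↦ tangentCoord x (σ y)) x +
            mvfderiv 𝓘(ℝ, E) (fun y ↦ tangentCoord x (τ y)) x :=
        hσ'.mvfderiv_add (b := fun y : N ↦ y) hτ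
      simp only [Φ, cov.isCovariantDerivativeOn.add hσ hτ, h, add_apply, map_add]
      abel
  have h := hΦ.pointwise (σ' := FiberBundle.extend E (Z x)) hZ
    (diffAlong_extend (Z x)) (by simp)
  simp only [Φ] at h
  rw [mvfderiv_tangentCoord_extend] at h
  simpa [sub_eq_iff_eq_add] using h

end Connection

/-! ### The pullback connection along an immersion -/

namespace ImmersedSubmanifold

variable {E F N M : Type*} [NormedAddCommGroup E] [NormedSpace ℝ E]
  [NormedAddCommGroup F] [NormedSpace ℝ F]
  [TopologicalSpace N] [ChartedSpace E N] [TopologicalSpace M] [ChartedSpace F M]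
  (f : ImmersedSubmanifold E F N M)
lemma mdifferentiableAt_ι (p : M) : MDifferentiableAt 𝓘(ℝ, F) 𝓘(ℝ, E) f.ι p :=
  (f.smooth p).mdifferentiableAt (by simp)

variable [IsManifold 𝓘(ℝ, E) ∞ N]
  (cov : CovariantDerivative 𝓘(ℝ, E) E (fun x : N ↦ TangentSpace 𝓘(ℝ, E) x))
  {V W : (p : M) → TangentSpace 𝓘(ℝ, E) (f.ι p)} {p : M}

lemma covAlong_apply (V : (p : M) → TangentSpace 𝓘(ℝ, E) (f.ι p)) (p : M)
    (v : TangentSpace 𝓘(ℝ, F) p) :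
    f.covAlong cov V p v = cov (FiberBundle.extend E (V p)) (f.ι p) (f.diff p v)
      + tangentOfCoord (f.ι p) (f.ι p)
          (mvfderiv 𝓘(ℝ, F) (fun q ↦ tangentCoord (f.ι p) (V q)) p v) := by
  rw [tangentOfCoord_apply _ (mem_tangentCoordDomain _)]
  rfl

lemma covAlong_add_dir (v w : TangentSpace 𝓘(ℝ, F) p) :
    f.covAlong cov V p (v + w) = f.covAlong cov V p v + f.covAlong cov V p w := by
  simp only [covAlong_apply, map_add]
  abel

lemma covAlong_smul_dir (c : ℝ) (v : TangentSpace 𝓘(ℝ, F) p) :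
    f.covAlong cov V p (c • v) = c • f.covAlong cov V p v := by
  simp only [covAlong_apply, map_smul, smul_add]

lemma covAlong_add (hV : DiffAlong F f.ι V p) (hW : DiffAlong F f.ι W p)
    (v : TangentSpace 𝓘(ℝ, F) p) :
    f.covAlong cov (fun q ↦ V q + W q) p v = f.covAlong cov V p v + f.covAlong cov W p v := by
  simp only [covAlong_apply, hV.mvfderiv_add hW, cov.extend_add, add_apply,
    map_add]
  abel

lemma covAlong_smul {g : M → ℝ} (hg : MDifferentiableAt 𝓘(ℝ, F) 𝓘(ℝ, ℝ) g p)
    (hV : DiffAlong F f.ι V p) (v : TangentSpace 𝓘(ℝ, F) p) :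
    f.covAlong cov (fun q ↦ g q • V q) p v =
      g p • f.covAlong cov V p v + mvfderiv 𝓘(ℝ, F) g p v • V p := by
  have e : tangentOfCoord (f.ι p) (f.ι p) (tangentCoord (f.ι p) (V p)) = V p :=
    tangentOfCoord_tangentCoord _ (mem_tangentCoordDomain _) _
  simp only [covAlong_apply, hV.mvfderiv_smul hg, cov.extend_smul, add_apply,
    map_add, smul_apply, map_smul, ContinuousLinearMap.smulRight_apply, e]
  module

variable [FiniteDimensional ℝ E]

/-- In coordinates both sides have the same tensorial term, and the flat terms agree by the chain
rule. -/
lemma covAlong_comp {Z : (x : N) → TangentSpace 𝓘(ℝ, E) x}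
    (hZ : DiffAlong E (fun y : N ↦ y) Z (f.ι p)) (v : TangentSpace 𝓘(ℝ, F) p) :
    f.covAlong cov (fun q ↦ Z (f.ι q)) p v = cov Z (f.ι p) (f.diff p v) := by
  rw [cov.eq_extend_add hZ, covAlong_apply]
  congr 2
  exact mfderiv_comp_apply p hZ.coord (f.mdifferentiableAt_ι p) v

end ImmersedSubmanifold

/-! ### Differentiating endomorphism fields -/

section EndField

variable {E F N M : Type*} [NormedAddCommGroup E] [NormedSpace ℝ E]
  [NormedAddCommGroup F] [NormedSpace ℝ F]
  [TopologicalSpace N] [ChartedSpace E N] [TopologicalSpace M] [ChartedSpace F M]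

lemma mvfderiv_clm_apply {G : Type*} [NormedAddCommGroup G] [NormedSpace ℝ G]
    {A : M → G →L[ℝ] E} {u : M → G} {p : M}
    (hA : MDifferentiableAt 𝓘(ℝ, F) 𝓘(ℝ, G →L[ℝ] E) A p)
    (hu : MDifferentiableAt 𝓘(ℝ, F) 𝓘(ℝ, G) u p) (v : TangentSpace 𝓘(ℝ, F) p) :
    mvfderiv 𝓘(ℝ, F) (fun q ↦ A q (u q)) p v =
      mvfderiv 𝓘(ℝ, F) A p v (u p) + A p (mvfderiv 𝓘(ℝ, F) u p v) := by
  have h := (hA.clm_apply hu).mvfderiv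
  have hA' := mdifferentiableAt_iff _ _ |>.1 hA
  have hu' := mdifferentiableAt_iff _ _ |>.1 hu
  rw [h, hA.mvfderiv, hu.mvfderiv]
  have hx : extChartAt 𝓘(ℝ, F) p p ∈ Set.range 𝓘(ℝ, F) := by simp
  have := fderivWithin_clm_apply (𝕜 := ℝ) (𝓘(ℝ, F).uniqueDiffOn _ hx) hA'.2 hu'.2
  have e : writtenInExtChartAt 𝓘(ℝ, F) 𝓘(ℝ, E) p (fun q ↦ A q (u q)) =
    fun y ↦ writtenInExtChartAt 𝓘(ℝ, F) 𝓘(ℝ, G →L[ℝ] E) p A y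
      (writtenInExtChartAt 𝓘(ℝ, F) 𝓘(ℝ, G) p u y) := rfl
  rw [e, this]
  have e1 : writtenInExtChartAt 𝓘(ℝ, F) 𝓘(ℝ, G →L[ℝ] E) p A (extChartAt 𝓘(ℝ, F) p p) = A p := by
    simp [writtenInExtChartAt]
    rfl
  have e2 : writtenInExtChartAt 𝓘(ℝ, F) 𝓘(ℝ, G) p u (extChartAt 𝓘(ℝ, F) p p) = u p := by
    simp [writtenInExtChartAt]
    rfl
  rw [e1, e2]
  exact add_comm _ _

variable [IsManifold 𝓘(ℝ, E) ∞ N]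
  {φ : (x : N) → TangentSpace 𝓘(ℝ, E) x →L[ℝ] TangentSpace 𝓘(ℝ, E) x}

/-- The matrix of a field of endomorphisms in the preferred trivialization around `x`. -/
noncomputable def endCoord (φ : (x : N) → TangentSpace 𝓘(ℝ, E) x →L[ℝ] TangentSpace 𝓘(ℝ, E) x)
    (x y : N) : E →L[ℝ] E :=
  ContinuousLinearMap.inCoordinates E (fun x : N ↦ TangentSpace 𝓘(ℝ, E) x) E
    (fun x : N ↦ TangentSpace 𝓘(ℝ, E) x) x y x y (φ y)

lemma endCoord_apply (x : N) {y : N} (hy : y ∈ tangentCoordDomain E x)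
    (w : TangentSpace 𝓘(ℝ, E) y) :
    endCoord φ x y (tangentCoord x w) = tangentCoord x (φ y w) := by
  rw [tangentCoord_eq x hy (φ y w)]
  have := tangentOfCoord_tangentCoord x hy w
  conv_rhs => rw [← this]
  rfl

lemma IsSmoothEndField.mdifferentiableAt_endCoord (hφ : IsSmoothEndField φ) (x : N) :
    MDifferentiableAt 𝓘(ℝ, E) 𝓘(ℝ, E →L[ℝ] E) (endCoord φ x) x :=
  ((contMDiffAt_hom_bundle _).1 (hφ x)).2.mdifferentiableAt (by simp)

lemma DiffAlong.endField {b : M → N} {V : (p : M) → TangentSpace 𝓘(ℝ, E) (b p)} {p : M}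
    (hφ : IsSmoothEndField φ) (hV : DiffAlong F b V p) :
    DiffAlong F b (fun q ↦ φ (b q) (V q)) p := by
  have h := ((hφ (b p)).mdifferentiableAt (by simp)).comp p hV.base
  exact MDifferentiableAt.clm_bundle_apply (E₁ := fun x : N ↦ TangentSpace 𝓘(ℝ, E) x)
    (E₂ := fun x : N ↦ TangentSpace 𝓘(ℝ, E) x) h hV

/-- Product rule for the matrix of `φ` composed with `b`. The term that differentiates the matrix
involves `V` only through its value at `p`, which is why `∇φ` can be computed with any field having
this value. -/
lemma DiffAlong.mvfderiv_endField {b : M → N} {V : (p : M) → TangentSpace 𝓘(ℝ, E) (b p)} {p : M}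
    (hφ : IsSmoothEndField φ) (hV : DiffAlong F b V p) (v : TangentSpace 𝓘(ℝ, F) p) :
    mvfderiv 𝓘(ℝ, F) (fun q ↦ tangentCoord (b p) (φ (b q) (V q))) p v =
      mvfderiv 𝓘(ℝ, E) (endCoord φ (b p)) (b p) (mfderiv 𝓘(ℝ, F) 𝓘(ℝ, E) b p v)
        (tangentCoord (b p) (V p)) +
      endCoord φ (b p) (b p) (mvfderiv 𝓘(ℝ, F) (fun q ↦ tangentCoord (b p) (V q)) p v) := by
  have h : (fun q ↦ tangentCoord (b p) (φ (b q) (V q))) =ᶠ[𝓝 p]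
      fun q ↦ endCoord φ (b p) (b q) (tangentCoord (b p) (V q)) := by
    filter_upwards [eventually_mem_tangentCoordDomain hV.base] with q hq
    exact (endCoord_apply _ hq _).symm
  have hΦ := hφ.mdifferentiableAt_endCoord (b p)
  rw [mvfderiv_congr_of_eventuallyEq h]
  refine (mvfderiv_clm_apply (hΦ.comp p hV.base) hV.coord v).trans ?_
  congr 2
  exact mfderiv_comp_apply p hΦ hV.base v

end EndField

namespace ImmersedSubmanifold

variable {E F N M : Type*} [NormedAddCommGroup E] [NormedSpace ℝ E] [FiniteDimensional ℝ E]
  [NormedAddCommGroup F] [NormedSpace ℝ F]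
  [TopologicalSpace N] [ChartedSpace E N] [IsManifold 𝓘(ℝ, E) ∞ N]
  [TopologicalSpace M] [ChartedSpace F M]
  (f : ImmersedSubmanifold E F N M)
  (cov : CovariantDerivative 𝓘(ℝ, E) E (fun x : N ↦ TangentSpace 𝓘(ℝ, E) x))
  {φ : (x : N) → TangentSpace 𝓘(ℝ, E) x →L[ℝ] TangentSpace 𝓘(ℝ, E) x}
  {V : (p : M) → TangentSpace 𝓘(ℝ, E) (f.ι p)} {p : M}

/-- The covariant derivative of an endomorphism field is the same whether it is computed with a
field along the immersion or with a field of the ambient manifold. -/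
lemma covAlong_endField (hφ : IsSmoothEndField φ) (hV : DiffAlong F f.ι V p)
    {W : (x : N) → TangentSpace 𝓘(ℝ, E) x} (hW : DiffAlong E (fun y : N ↦ y) W (f.ι p))
    (hVW : W (f.ι p) = V p) (v : TangentSpace 𝓘(ℝ, F) p) :
    f.covAlong cov (fun q ↦ φ (f.ι q) (V q)) p v =
      φ (f.ι p) (f.covAlong cov V p v) + cov (fun y ↦ φ y (W y)) (f.ι p) (f.diff p v)
        - φ (f.ι p) (cov W (f.ι p) (f.diff p v)) := by
  -- Passing from coordinates to vectors intertwines the matrix of `φ` with `φ` itself.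
  have key (u : E) : φ (f.ι p) (tangentOfCoord (f.ι p) (f.ι p) u) =
      tangentOfCoord (f.ι p) (f.ι p) (endCoord φ (f.ι p) (f.ι p) u) := by
    conv_rhs => rw [← tangentCoord_tangentOfCoord (f.ι p) (mem_tangentCoordDomain _) u,
      endCoord_apply _ (mem_tangentCoordDomain _),
      tangentOfCoord_tangentCoord _ (mem_tangentCoordDomain _)]
  have hW' : mvfderiv 𝓘(ℝ, E) (fun y ↦ tangentCoord (f.ι p) (φ y (W y))) (f.ι p) (f.diff p v) =
      mvfderiv 𝓘(ℝ, E) (endCoord φ (f.ι p)) (f.ι p) (f.diff p v)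
        (tangentCoord (f.ι p) (W (f.ι p))) +
      endCoord φ (f.ι p) (f.ι p)
        (mvfderiv 𝓘(ℝ, E) (fun y ↦ tangentCoord (f.ι p) (W y)) (f.ι p) (f.diff p v)) := by
    have := hW.mvfderiv_endField (b := fun y : N ↦ y) hφ (f.diff p v)
    rwa [show (fun y : N ↦ y) = id from rfl, mfderiv_id] at this
  rw [cov.eq_extend_add (hW.endField (b := fun y : N ↦ y) hφ), cov.eq_extend_add hW, hW', hVW,
    covAlong_apply, covAlong_apply, hV.mvfderiv_endField hφ]
  simp only [map_add, key]
  change _ + (tangentOfCoord (f.ι p) (f.ι p) (mvfderiv 𝓘(ℝ, E) (endCoord φ (f.ι p)) (f.ι p)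
    (f.diff p v) _) + _) = _
  abel

end ImmersedSubmanifold

/-! ### The Lie bracket in coordinates -/

section Bracket

variable {E F M : Type*} [NormedAddCommGroup E] [NormedSpace ℝ E]
  [NormedAddCommGroup F] [NormedSpace ℝ F]
  [TopologicalSpace M] [ChartedSpace F M] [IsManifold 𝓘(ℝ, F) ∞ M]

lemma mem_tangentCoordDomain_iff {p q : M} :
    q ∈ tangentCoordDomain F p ↔ q ∈ (chartAt F p).source := Iff.rfl

lemma tangentCoord_eq_mfderiv {p q : M} (hq : q ∈ tangentCoordDomain F p)
    (v : TangentSpace 𝓘(ℝ, F) q) :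
    tangentCoord p v = mfderiv 𝓘(ℝ, F) 𝓘(ℝ, F) (extChartAt 𝓘(ℝ, F) p) q v := by
  rw [tangentCoord_eq p hq]
  exact congrArg (fun L ↦ L v) (TangentBundle.continuousLinearMapAt_trivializationAt hq)

lemma tangentCoord_self (p : M) (v : TangentSpace 𝓘(ℝ, F) p) : tangentCoord p v = v := by
  rw [tangentCoord_eq_mfderiv (mem_tangentCoordDomain p)]
  exact congrArg (fun L ↦ L v) (mfderiv_extChartAt_self (I := 𝓘(ℝ, F)) (x := p))

/-- The Lie bracket is defined through pullback by the inverse chart. Its differential is inverse to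
that of the chart, which is what the trivialization uses, so both give the same local
representative. -/
lemma mpullbackWithin_extChartAt_symm_eventuallyEq (p : M) (Y : (q : M) → TangentSpace 𝓘(ℝ, F) q) :
    (mpullbackWithin 𝓘(ℝ, F) 𝓘(ℝ, F) (extChartAt 𝓘(ℝ, F) p).symm Y (Set.range 𝓘(ℝ, F)))
      =ᶠ[𝓝 (extChartAt 𝓘(ℝ, F) p p)]
    writtenInExtChartAt 𝓘(ℝ, F) 𝓘(ℝ, F) p (fun q ↦ tangentCoord p (Y q)) := by
  filter_upwards [extChartAt_target_mem_nhds (I := 𝓘(ℝ, F)) p] with z hz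
  have hs : (extChartAt 𝓘(ℝ, F) p).symm z ∈ tangentCoordDomain F p := by
    rw [mem_tangentCoordDomain_iff, ← extChartAt_source 𝓘(ℝ, F)]
    exact (extChartAt 𝓘(ℝ, F) p).map_target hz
  have h1 := mfderiv_extChartAt_comp_mfderivWithin_extChartAt_symm (I := 𝓘(ℝ, F)) hz
  have h2 := isInvertible_mfderivWithin_extChartAt_symm (I := 𝓘(ℝ, F)) hz
  rw [mpullbackWithin_apply]
  change _ = tangentCoord p (Y ((extChartAt 𝓘(ℝ, F) p).symm z))
  rw [tangentCoord_eq_mfderiv hs]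
  obtain ⟨e, he⟩ := h2
  rw [← he, ContinuousLinearMap.inverse_equiv] 
  rw [← he] at h1
  have := congrArg (fun L ↦ L (e.symm (Y ((extChartAt 𝓘(ℝ, F) p).symm z)))) h1
  refine this.symm.trans ?_
  change mfderiv 𝓘(ℝ, F) 𝓘(ℝ, F) (extChartAt 𝓘(ℝ, F) p) _ (e (e.symm _)) = _
  rw [e.apply_symm_apply]

/-- The Lie bracket in the coordinates of the preferred trivialization around the point. -/
lemma mlieBracket_eq_mvfderiv {X Y : (q : M) → TangentSpace 𝓘(ℝ, F) q} {p : M}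
    (hX : DiffAlong F (fun q : M ↦ q) X p) (hY : DiffAlong F (fun q : M ↦ q) Y p) :
    mlieBracket 𝓘(ℝ, F) X Y p =
      mvfderiv 𝓘(ℝ, F) (fun q ↦ tangentCoord p (Y q)) p (X p) -
        mvfderiv 𝓘(ℝ, F) (fun q ↦ tangentCoord p (X q)) p (Y p) := by
  have hX' := mpullbackWithin_extChartAt_symm_eventuallyEq p X
  have hY' := mpullbackWithin_extChartAt_symm_eventuallyEq p Y
  set A : F → F := mpullbackWithin 𝓘(ℝ, F) 𝓘(ℝ, F) (extChartAt 𝓘(ℝ, F) p).symm X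
    (Set.range 𝓘(ℝ, F))
  set B : F → F := mpullbackWithin 𝓘(ℝ, F) 𝓘(ℝ, F) (extChartAt 𝓘(ℝ, F) p).symm Y
    (Set.range 𝓘(ℝ, F))
  have hA : A (extChartAt 𝓘(ℝ, F) p p) = X p := by
    rw [hX'.self_of_nhds]
    change tangentCoord p (X ((extChartAt 𝓘(ℝ, F) p).symm (extChartAt 𝓘(ℝ, F) p p))) = X p
    rw [extChartAt_to_inv, tangentCoord_self]
  have hB : B (extChartAt 𝓘(ℝ, F) p p) = Y p := by
    rw [hY'.self_of_nhds]
    change tangentCoord p (Y ((extChartAt 𝓘(ℝ, F) p).symm (extChartAt 𝓘(ℝ, F) p p))) = Y p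
    rw [extChartAt_to_inv, tangentCoord_self]
  have h : mlieBracket 𝓘(ℝ, F) X Y p = (ContinuousLinearMap.id ℝ F).inverse
      (lieBracketWithin ℝ A B ((extChartAt 𝓘(ℝ, F) p).symm ⁻¹' Set.univ ∩ Set.range 𝓘(ℝ, F))
        (extChartAt 𝓘(ℝ, F) p p)) := by
    rw [← mlieBracketWithin_univ, mlieBracketWithin_apply]
    exact congrArg (fun L : F →L[ℝ] F ↦ L.inverse _)
      (mfderiv_extChartAt_self (I := 𝓘(ℝ, F)) (x := p))
  rw [h, ContinuousLinearMap.inverse_id, hX.coord.mvfderiv, hY.coord.mvfderiv]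
  simp only [lieBracketWithin, modelWithCornersSelf_coe, Set.range_id, Set.preimage_univ,
    Set.inter_univ, fderivWithin_univ, hA, hB]
  rw [hX'.fderiv_eq, hY'.fderiv_eq]
  rfl

/-- The second derivatives of a smooth function on a manifold, computed along vector fields,
commute up to the Lie bracket. -/
lemma mvfderiv_mvfderiv_sub {u : M → E} {X Y : (q : M) → TangentSpace 𝓘(ℝ, F) q} {p : M}
    (hu : ContMDiffAt 𝓘(ℝ, F) 𝓘(ℝ, E) ∞ u p)
    (hX : DiffAlong F (fun q : M ↦ q) X p) (hY : DiffAlong F (fun q : M ↦ q) Y p) :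
    mvfderiv 𝓘(ℝ, F) (fun q ↦ mvfderiv 𝓘(ℝ, F) u q (Y q)) p (X p) -
      mvfderiv 𝓘(ℝ, F) (fun q ↦ mvfderiv 𝓘(ℝ, F) u q (X q)) p (Y p) =
    mvfderiv 𝓘(ℝ, F) u p (mlieBracket 𝓘(ℝ, F) X Y p) := by
  set ψ := extChartAt 𝓘(ℝ, F) p with hψ
  set U : F → E := u ∘ ψ.symm with hU
  have hUd : ContDiffAt ℝ ∞ U (ψ p) := by
    have := (contMDiffAt_iff.1 hu).2
    simp only [modelWithCornersSelf_coe, Set.range_id] at this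
    exact contDiffWithinAt_univ.1 this
  have hU2 : ContDiffAt ℝ 2 U (ψ p) := hUd.of_le ENat.LEInfty.out
  -- The factorization is needed on a neighbourhood, not just at `p`, because it is differentiated
  -- once more below.
  have hU' : ∀ᶠ q in 𝓝 p, mvfderiv 𝓘(ℝ, F) u q =
      (fderiv ℝ U (ψ q)).comp (mfderiv 𝓘(ℝ, F) 𝓘(ℝ, F) ψ q) := by
    have hc : ContinuousAt ψ p := continuousAt_extChartAt p
    have h1 := hc.eventually (hU2.eventually (by simp))
    filter_upwards [h1, extChartAt_source_mem_nhds (I := 𝓘(ℝ, F)) p] with q hq hqs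
    have he : u =ᶠ[𝓝 q] U ∘ ψ := by
      filter_upwards [extChartAt_source_mem_nhds' (I := 𝓘(ℝ, F)) hqs] with r hr
      simp [hU, ψ.left_inv hr]
    rw [mvfderiv_congr_of_eventuallyEq he]
    have hUq : MDifferentiableAt 𝓘(ℝ, F) 𝓘(ℝ, E) U (ψ q) :=
      (hq.differentiableAt (by simp)).mdifferentiableAt
    have := mfderiv_comp q hUq (mdifferentiableAt_extChartAt (I := 𝓘(ℝ, F)) (by
      simpa [hψ] using hqs))
    rw [mfderiv_eq_fderiv] at this
    exact this
  have hD : MDifferentiableAt 𝓘(ℝ, F) 𝓘(ℝ, F →L[ℝ] E) (fun q ↦ fderiv ℝ U (ψ q)) p := by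
    have h2 : DifferentiableAt ℝ (fderiv ℝ U) (ψ p) :=
      (hUd.fderiv_right (m := 1) (by norm_cast)).differentiableAt (by simp)
    exact h2.mdifferentiableAt.comp p (mdifferentiableAt_extChartAt (by simp))
  have key (Z : (q : M) → TangentSpace 𝓘(ℝ, F) q) (hZ : DiffAlong F (fun q : M ↦ q) Z p)
      (v : TangentSpace 𝓘(ℝ, F) p) :
      mvfderiv 𝓘(ℝ, F) (fun q ↦ mvfderiv 𝓘(ℝ, F) u q (Z q)) p v =
        fderiv ℝ (fderiv ℝ U) (ψ p) v (Z p) +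
          fderiv ℝ U (ψ p) (mvfderiv 𝓘(ℝ, F) (fun q ↦ tangentCoord p (Z q)) p v) := by
    have h1 : (fun q ↦ mvfderiv 𝓘(ℝ, F) u q (Z q)) =ᶠ[𝓝 p]
        fun q ↦ fderiv ℝ U (ψ q) (tangentCoord p (Z q)) := by
      filter_upwards [hU', tangentCoordDomain_mem_nhds (E := F) p] with q hq hqs
      rw [hq, tangentCoord_eq_mfderiv hqs]
      rfl
    rw [mvfderiv_congr_of_eventuallyEq h1, mvfderiv_clm_apply hD hZ.coord, tangentCoord_self]
    congr 2
    have h2 : DifferentiableAt ℝ (fderiv ℝ U) (ψ p) :=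
      (hUd.fderiv_right (m := 1) (by norm_cast)).differentiableAt (by simp)
    have h3 := mfderiv_comp_apply p h2.mdifferentiableAt
      (mdifferentiableAt_extChartAt (I := 𝓘(ℝ, F)) (x := p) (by simp)) v
    rw [mfderiv_eq_fderiv, mfderiv_extChartAt_self] at h3
    exact h3
  -- Symmetry cancels the second-order terms; the first-order ones combine to `dU` of the bracket.
  have hsymm : IsSymmSndFDerivAt ℝ U (ψ p) := hU2.isSymmSndFDerivAt (by simp)
  rw [key Y hY, key X hX, hU'.self_of_nhds, mlieBracket_eq_mvfderiv hX hY,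
    hsymm.eq (X p) (Y p), mfderiv_extChartAt_self]
  change _ = fderiv ℝ U (ψ p) (_ - _)
  rw [map_sub]
  abel

end Bracket

lemma IsSmoothField.diffAlong {E N : Type*} [NormedAddCommGroup E] [NormedSpace ℝ E]
    [TopologicalSpace N] [ChartedSpace E N] [IsManifold 𝓘(ℝ, E) ∞ N]
    {X : (x : N) → TangentSpace 𝓘(ℝ, E) x} (hX : IsSmoothField X) (x : N) :
    DiffAlong E (fun y : N ↦ y) X x :=
  (hX x).mdifferentiableAt (by simp)

/-- Every tangent vector is the value of a smooth vector field. -/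
lemma exists_isSmoothField {E N : Type*} [NormedAddCommGroup E] [NormedSpace ℝ E]
    [FiniteDimensional ℝ E] [TopologicalSpace N] [T2Space N] [ChartedSpace E N]
    [IsManifold 𝓘(ℝ, E) ∞ N] {x : N} (w : TangentSpace 𝓘(ℝ, E) x) :
    ∃ X : (y : N) → TangentSpace 𝓘(ℝ, E) y, IsSmoothField X ∧ X x = w := by
  obtain ⟨s, hs, hX⟩ := FiberBundle.exists_contMDiffOn_extend (k := ∞) 𝓘(ℝ, E) E
    (V := fun y : N ↦ TangentSpace 𝓘(ℝ, E) y) w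
  obtain ⟨t, hts, ht, hxt⟩ := mem_nhds_iff.1 hs
  obtain ⟨ρ, -, hρ⟩ := (SmoothBumpFunction.nhds_basis_tsupport (I := 𝓘(ℝ, E)) x).mem_iff.1
    (ht.mem_nhds hxt)
  refine ⟨fun y ↦ ρ y • FiberBundle.extend E (E := fun y : N ↦ TangentSpace 𝓘(ℝ, E) y) w y,
    ?_, ?_⟩
  · exact ContMDiffOn.smul_section_of_tsupport (V := fun y : N ↦ TangentSpace 𝓘(ℝ, E) y)
      (ρ.contMDiff.contMDiffOn) ht hρ (hX.mono hts)
  · simp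

/-! ### Torsion of the pullback connection -/

namespace ImmersedSubmanifold

variable {E F N M : Type*} [NormedAddCommGroup E] [NormedSpace ℝ E]
  [NormedAddCommGroup F] [NormedSpace ℝ F]
  [TopologicalSpace N] [ChartedSpace E N] [IsManifold 𝓘(ℝ, E) ∞ N]
  [TopologicalSpace M] [ChartedSpace F M]
  (f : ImmersedSubmanifold E F N M)
  {X Y : (p : M) → TangentSpace 𝓘(ℝ, F) p} {p : M}

/-- This turns the coordinates of a pushed-forward field into derivatives of one vector-valued
function, so that the commutation of second derivatives applies to them. -/
lemma tangentCoord_push (p : M) (X : (p : M) → TangentSpace 𝓘(ℝ, F) p) :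
    (fun q ↦ tangentCoord (f.ι p) (f.push X q)) =ᶠ[𝓝 p]
      fun q ↦ mvfderiv 𝓘(ℝ, F) (extChartAt 𝓘(ℝ, E) (f.ι p) ∘ f.ι) q (X q) := by
  filter_upwards [eventually_mem_tangentCoordDomain (f.mdifferentiableAt_ι p)] with q hq
  rw [tangentCoord_eq_mfderiv hq]
  have h := mfderiv_comp_apply q (mdifferentiableAt_extChartAt (I := 𝓘(ℝ, E)) hq)
    (f.mdifferentiableAt_ι q) (X q)
  exact h.symm

variable [IsManifold 𝓘(ℝ, F) ∞ M]

lemma diffAlong_push (hX : DiffAlong F (fun q : M ↦ q) X p) : DiffAlong F f.ι (f.push X) p :=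
  ((f.smooth.contMDiff_tangentMap (m := ∞) (by simp)).contMDiffAt.mdifferentiableAt
    (by simp)).comp p hX

variable [FiniteDimensional ℝ E]
  {cov : CovariantDerivative 𝓘(ℝ, E) E (fun x : N ↦ TangentSpace 𝓘(ℝ, E) x)}

/-- Fields with constant coordinates have zero bracket at `x`: this is the symmetry of the
Christoffel symbols. -/
lemma _root_.CovariantDerivative.extend_symm (hcov : cov.torsion = 0) {x : N}
    (v w : TangentSpace 𝓘(ℝ, E) x) :
    cov (FiberBundle.extend E v) x w = cov (FiberBundle.extend E w) x v := by
  have h := cov.torsion_eq_zero_iff.1 hcov (diffAlong_extend w) (diffAlong_extend v)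
  have h2 := mlieBracket_eq_mvfderiv (diffAlong_extend w) (diffAlong_extend v)
  rw [mvfderiv_tangentCoord_extend, mvfderiv_tangentCoord_extend] at h2
  erw [h2] at h
  simp only [FiberBundle.extend_apply_self, zero_apply, sub_self] at h
  exact sub_eq_zero.1 h

/-- The pullback of a torsion-free connection to a submanifold is torsion-free. -/
lemma covAlong_push_sub (hcov : cov.torsion = 0) (hX : DiffAlong F (fun q : M ↦ q) X p)
    (hY : DiffAlong F (fun q : M ↦ q) Y p) :
    f.covAlong cov (f.push Y) p (X p) - f.covAlong cov (f.push X) p (Y p) =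
      f.diff p (mlieBracket 𝓘(ℝ, F) X Y p) := by
  have hu : ContMDiffAt 𝓘(ℝ, F) 𝓘(ℝ, E) ∞ (extChartAt 𝓘(ℝ, E) (f.ι p) ∘ f.ι) p :=
    contMDiffAt_extChartAt.comp p (f.smooth p)
  have h := mvfderiv_mvfderiv_sub hu hX hY
  have hZ := (f.tangentCoord_push p (mlieBracket 𝓘(ℝ, F) X Y)).self_of_nhds
  beta_reduce at hZ
  have e : f.diff p (mlieBracket 𝓘(ℝ, F) X Y p) = tangentOfCoord (f.ι p) (f.ι p)
      (tangentCoord (f.ι p) (f.push (mlieBracket 𝓘(ℝ, F) X Y) p)) :=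
    (tangentOfCoord_tangentCoord _ (mem_tangentCoordDomain _) _).symm
  rw [e, hZ, ← h, covAlong_apply, covAlong_apply,
    mvfderiv_congr_of_eventuallyEq (f.tangentCoord_push p X),
    mvfderiv_congr_of_eventuallyEq (f.tangentCoord_push p Y), map_sub]
  have := CovariantDerivative.extend_symm hcov (f.push Y p) (f.push X p)
  change cov _ _ (f.push X p) + _ - (cov _ _ (f.push Y p) + _) = _
  rw [this]
  abel

end ImmersedSubmanifold

/-! ### Smoothness of fields and forms on the submanifold -/

namespace ImmersedSubmanifold

variable {E F N M : Type*} [NormedAddCommGroup E] [NormedSpace ℝ E]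
  [NormedAddCommGroup F] [NormedSpace ℝ F]
  [TopologicalSpace N] [ChartedSpace E N] [IsManifold 𝓘(ℝ, E) ∞ N]
  [TopologicalSpace M] [ChartedSpace F M] [IsManifold 𝓘(ℝ, F) ∞ M]
  (f : ImmersedSubmanifold E F N M)
  {X : (p : M) → TangentSpace 𝓘(ℝ, F) p}

/-- The matrix of the differential of the immersion in the preferred trivializations around `p`. -/
noncomputable def diffCoord (p q : M) : F →L[ℝ] E :=
  inTangentCoordinates 𝓘(ℝ, F) 𝓘(ℝ, E) id f.ι (mfderiv 𝓘(ℝ, F) 𝓘(ℝ, E) f.ι) p q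

lemma contMDiffAt_diffCoord (p : M) :
    ContMDiffAt 𝓘(ℝ, F) 𝓘(ℝ, F →L[ℝ] E) ∞ (f.diffCoord p) p :=
  (f.smooth p).mfderiv_const (by simp)

lemma diffCoord_apply' {p q : M} (v : F) (hq : f.ι q ∈ tangentCoordDomain E (f.ι p)) :
    f.diffCoord p q v = tangentCoord (f.ι p) (f.diff q (tangentOfCoord p q v)) := by
  rw [tangentCoord_eq (f.ι p) hq]
  rfl

lemma diffCoord_apply {p q : M} (hq : q ∈ tangentCoordDomain F p)
    (hq' : f.ι q ∈ tangentCoordDomain E (f.ι p)) (v : TangentSpace 𝓘(ℝ, F) q) :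
    f.diffCoord p q (tangentCoord p v) = tangentCoord (f.ι p) (f.diff q v) := by
  rw [f.diffCoord_apply' _ hq', tangentOfCoord_tangentCoord p hq]

lemma diffCoord_injective (p : M) : Function.Injective (f.diffCoord p p) := by
  intro v w h
  rw [f.diffCoord_apply' _ (mem_tangentCoordDomain _),
    f.diffCoord_apply' _ (mem_tangentCoordDomain _), tangentCoord_self, tangentCoord_self] at h
  have := congrArg (fun u : TangentSpace 𝓘(ℝ, F) p ↦ tangentCoord p u) (f.immersive p h)
  simpa only [tangentCoord_tangentOfCoord p (mem_tangentCoordDomain p)] using this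

/-- A vector field of a submanifold is smooth if it is smooth as a field of the ambient manifold
along the immersion. -/
lemma isSmoothField_of_push [FiniteDimensional ℝ E] [FiniteDimensional ℝ F]
    (hX : ContMDiff 𝓘(ℝ, F) 𝓘(ℝ, E).tangent ∞
      (fun q ↦ (⟨f.ι q, f.push X q⟩ : TangentBundle 𝓘(ℝ, E) N))) :
    IsSmoothField X := by
  intro p
  have hXp : ContMDiffAt 𝓘(ℝ, F) 𝓘(ℝ, E) ∞ (fun q ↦ tangentCoord (f.ι p) (f.push X q)) p :=
    ((contMDiffAt_totalSpace (IB := 𝓘(ℝ, E))).1 (hX p)).2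
  refine (contMDiffAt_section (E := fun q : M ↦ TangentSpace 𝓘(ℝ, F) q) p).2 ?_
  change ContMDiffAt 𝓘(ℝ, F) 𝓘(ℝ, F) ∞ (fun q ↦ tangentCoord p (X q)) p
  -- With a fixed left inverse `L` of the differential at `p`, the maps `A q = L ∘ dι_q` are the
  -- identity at `p`, hence invertible nearby with smooth inverse. Near `p`, then, `X = A⁻¹ L (dι
  -- X)` in coordinates.
  obtain ⟨L, hL⟩ := (f.diffCoord p p).toLinearMap.exists_leftInverse_of_injective
    (LinearMap.ker_eq_bot.2 (f.diffCoord_injective p))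
  let A : M → F →L[ℝ] F := fun q ↦ (L.toContinuousLinearMap).comp (f.diffCoord p q)
  have hA : ContMDiffAt 𝓘(ℝ, F) 𝓘(ℝ, F →L[ℝ] F) ∞ A p :=
    contMDiffAt_const.clm_comp (f.contMDiffAt_diffCoord p)
  have hAp : A p = (ContinuousLinearEquiv.refl ℝ F : F →L[ℝ] F) := by
    ext v
    exact congrArg (fun T ↦ T v) hL
  have hinv : ContMDiffAt 𝓘(ℝ, F) 𝓘(ℝ, F →L[ℝ] F) ∞ (fun q ↦ (A q).inverse) p := by
    have h := contDiffAt_map_inverse (𝕜 := ℝ) (n := ∞) (ContinuousLinearEquiv.refl ℝ F)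
    rw [← hAp] at h
    exact h.contMDiffAt.comp p hA
  have hev : ∀ᶠ q in 𝓝 p, ∃ e : F ≃L[ℝ] F, (e : F →L[ℝ] F) = A q := by
    have h : Set.range ((↑) : (F ≃L[ℝ] F) → F →L[ℝ] F) ∈ 𝓝 (A p) := by
      rw [hAp]
      exact (ContinuousLinearEquiv.refl ℝ F).nhds
    exact hA.continuousAt h
  refine (hinv.clm_apply (contMDiffAt_const (c := L.toContinuousLinearMap).clm_apply
    hXp)).congr_of_eventuallyEq ?_
  filter_upwards [hev, eventually_mem_tangentCoordDomain (f.mdifferentiableAt_ι p),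
    tangentCoordDomain_mem_nhds (E := F) p] with q ⟨e, he⟩ hq hq'
  have h1 : L.toContinuousLinearMap (tangentCoord (f.ι p) (f.push X q)) =
      A q (tangentCoord p (X q)) := by
    change _ = L.toContinuousLinearMap (f.diffCoord p q (tangentCoord p (X q)))
    rw [f.diffCoord_apply hq' hq]
    rfl
  rw [h1, ← he, ContinuousLinearMap.inverse_equiv]
  exact (e.symm_apply_apply _).symm

/-- The pullback of a smooth `1`-form to a submanifold is smooth. -/
lemma isSmoothOneForm_comp_diff {η : (x : N) → TangentSpace 𝓘(ℝ, E) x →L[ℝ] ℝ}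
    (hη : IsSmoothOneForm η) : IsSmoothOneForm (fun p ↦ (η (f.ι p)).comp (f.diff p)) := by
  intro p
  refine (contMDiffAt_hom_bundle _).2 ⟨contMDiffAt_id, ?_⟩
  have h1 := ((contMDiffAt_hom_bundle _).1 (hη (f.ι p))).2.comp p (f.smooth p)
  refine (h1.clm_comp (f.contMDiffAt_diffCoord p)).congr_of_eventuallyEq ?_
  filter_upwards [eventually_mem_tangentCoordDomain (f.mdifferentiableAt_ι p)] with q hq
  ext v
  have h2 := tangentOfCoord_tangentCoord (f.ι p) hq (f.diff q (tangentOfCoord p q v))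
  rw [← f.diffCoord_apply' v hq] at h2
  change (Trivialization.continuousLinearMapAt ℝ (trivializationAt ℝ (Bundle.Trivial M ℝ) p) q)
      (η (f.ι q) (f.diff q (tangentOfCoord p q v))) =
    (Trivialization.continuousLinearMapAt ℝ (trivializationAt ℝ (Bundle.Trivial N ℝ) (f.ι p))
      (f.ι q)) (η (f.ι q) (tangentOfCoord (f.ι p) (f.ι q) (f.diffCoord p q v)))
  rw [h2]
  simp

end ImmersedSubmanifold

lemma AlmostContactMetric.semisymmetric_apply {E N : Type*} [NormedAddCommGroup E]
    [NormedSpace ℝ E] [FiniteDimensional ℝ E] [TopologicalSpace N] [ChartedSpace E N]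
    [IsManifold 𝓘(ℝ, E) ∞ N] [RiemannianBundle (fun x : N ↦ TangentSpace 𝓘(ℝ, E) x)]
    (S : AlmostContactMetric E N)
    (cov : CovariantDerivative 𝓘(ℝ, E) E (fun x : N ↦ TangentSpace 𝓘(ℝ, E) x))
    (Y : (x : N) → TangentSpace 𝓘(ℝ, E) x) (x : N) (v : TangentSpace 𝓘(ℝ, E) x) :
    S.semisymmetric cov Y x v = cov Y x v + S.η x (Y x) • v - inner ℝ (Y x) v • S.ξ x :=
  rfl

/-! ### Tangential and normal parts, and the second fundamental form -/

namespace ImmersedSubmanifold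

variable {E F N M : Type*} [NormedAddCommGroup E] [NormedSpace ℝ E] [FiniteDimensional ℝ E]
  [NormedAddCommGroup F] [NormedSpace ℝ F]
  [TopologicalSpace N] [ChartedSpace E N] [IsManifold 𝓘(ℝ, E) ∞ N]
  [RiemannianBundle (fun x : N ↦ TangentSpace 𝓘(ℝ, E) x)]
  [TopologicalSpace M] [ChartedSpace F M]
  (f : ImmersedSubmanifold E F N M) {p : M}

lemma tangentialPart_add (v w : TangentSpace 𝓘(ℝ, E) (f.ι p)) :
    f.tangentialPart p (v + w) = f.tangentialPart p v + f.tangentialPart p w := by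
  rw [tangentialPart, map_add]
  exact map_add _ _ _

lemma tangentialPart_smul (c : ℝ) (v : TangentSpace 𝓘(ℝ, E) (f.ι p)) :
    f.tangentialPart p (c • v) = c • f.tangentialPart p v := by
  rw [tangentialPart, map_smul]
  exact map_smul _ _ _

lemma diff_tangentialPart {w : TangentSpace 𝓘(ℝ, E) (f.ι p)} (hw : w ∈ f.tangentSubspace p) :
    f.diff p (f.tangentialPart p w) = w := by
  have h := LinearEquiv.apply_symm_apply
    (LinearEquiv.ofInjective (f.diff p).toLinearMap (f.immersive p))
    ((f.tangentSubspace p).orthogonalProjectionOnto w)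
  have h2 := congrArg Subtype.val h
  refine h2.trans ?_
  exact Submodule.starProjection_eq_self_iff.2 hw

lemma diff_mem_tangentSubspace (v : TangentSpace 𝓘(ℝ, F) p) :
    f.diff p v ∈ f.tangentSubspace p := ⟨v, rfl⟩

lemma normalPart_add (v w : TangentSpace 𝓘(ℝ, E) (f.ι p)) :
    f.normalPart p (v + w) = f.normalPart p v + f.normalPart p w := by
  simp only [normalPart, tangentialPart_add, map_add]
  abel

lemma normalPart_smul (c : ℝ) (v : TangentSpace 𝓘(ℝ, E) (f.ι p)) :
    f.normalPart p (c • v) = c • f.normalPart p v := by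
  simp only [normalPart, tangentialPart_smul, map_smul, smul_sub]

lemma normalPart_eq_zero {w : TangentSpace 𝓘(ℝ, E) (f.ι p)} (hw : w ∈ f.tangentSubspace p) :
    f.normalPart p w = 0 := by
  rw [normalPart, f.diff_tangentialPart hw, sub_self]

lemma normalPart_add_of_mem (v : TangentSpace 𝓘(ℝ, E) (f.ι p))
    {w : TangentSpace 𝓘(ℝ, E) (f.ι p)} (hw : w ∈ f.tangentSubspace p) :
    f.normalPart p (v + w) = f.normalPart p v := by
  rw [normalPart_add, f.normalPart_eq_zero hw, add_zero]

variable [IsManifold 𝓘(ℝ, F) ∞ M] [FiniteDimensional ℝ F]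
  {cov : CovariantDerivative 𝓘(ℝ, E) E (fun x : N ↦ TangentSpace 𝓘(ℝ, E) x)}

section TorsionFree

/-- The two derivatives differ by the bracket, which is tangent to the submanifold. -/
lemma normalPart_covAlong_push_swap (hcov : cov.torsion = 0)
    {X Y : (p : M) → TangentSpace 𝓘(ℝ, F) p}
    (hX : DiffAlong F (fun q : M ↦ q) X p) (hY : DiffAlong F (fun q : M ↦ q) Y p) :
    f.normalPart p (f.covAlong cov (f.push Y) p (X p)) =
      f.normalPart p (f.covAlong cov (f.push X) p (Y p)) := by
  rw [sub_eq_iff_eq_add'.1 (f.covAlong_push_sub hcov hX hY),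
    f.normalPart_add_of_mem _ (f.diff_mem_tangentSubspace _)]

/-- The second fundamental form is the normal part of the ambient derivative of any tangent
field. -/
lemma secondForm_eq (hcov : cov.torsion = 0) {Y : (p : M) → TangentSpace 𝓘(ℝ, F) p}
    (hY : DiffAlong F (fun q : M ↦ q) Y p) (v : TangentSpace 𝓘(ℝ, F) p) :
    f.secondForm cov p v (Y p) = f.normalPart p (f.covAlong cov (f.push Y) p v) := by
  -- After the swap the extension of `v` is differentiated along `Y p`, so only the value `Y p`
  -- matters; the same swap for the extension of `Y p` ends at the same vector.
  have h1 := f.normalPart_covAlong_push_swap hcov (diffAlong_extend v) hY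
  have h2 := f.normalPart_covAlong_push_swap hcov (diffAlong_extend v) (diffAlong_extend (Y p))
  rw [FiberBundle.extend_apply_self] at h1 h2
  rw [FiberBundle.extend_apply_self] at h2
  exact h2.trans h1.symm

lemma secondForm_symm (hcov : cov.torsion = 0) (v w : TangentSpace 𝓘(ℝ, F) p) :
    f.secondForm cov p v w = f.secondForm cov p w v := by
  have h := f.normalPart_covAlong_push_swap hcov (diffAlong_extend v) (diffAlong_extend w)
  rw [FiberBundle.extend_apply_self, FiberBundle.extend_apply_self] at h
  exact h

lemma secondForm_add_left (u v w : TangentSpace 𝓘(ℝ, F) p) :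
    f.secondForm cov p (u + v) w = f.secondForm cov p u w + f.secondForm cov p v w := by
  simp only [secondForm, covAlong_add_dir, normalPart_add]

lemma secondForm_smul_left (c : ℝ) (v w : TangentSpace 𝓘(ℝ, F) p) :
    f.secondForm cov p (c • v) w = c • f.secondForm cov p v w := by
  simp only [secondForm, covAlong_smul_dir, normalPart_smul]

lemma secondForm_add_right (hcov : cov.torsion = 0) (u v w : TangentSpace 𝓘(ℝ, F) p) :
    f.secondForm cov p u (v + w) = f.secondForm cov p u v + f.secondForm cov p u w := by
  simp only [f.secondForm_symm hcov u, secondForm_add_left]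

lemma secondForm_smul_right (hcov : cov.torsion = 0) (c : ℝ) (v w : TangentSpace 𝓘(ℝ, F) p) :
    f.secondForm cov p v (c • w) = c • f.secondForm cov p v w := by
  simp only [f.secondForm_symm hcov v, secondForm_smul_left]

end TorsionFree

section Invariant

variable {S : AlmostContactMetric E N}

lemma covAlong_semisymmetric (V : (p : M) → TangentSpace 𝓘(ℝ, E) (f.ι p))
    (v : TangentSpace 𝓘(ℝ, F) p) :
    f.covAlong (S.semisymmetric cov) V p v = f.covAlong cov V p v +
      (S.η (f.ι p) (V p) • f.diff p v - inner ℝ (V p) (f.diff p v) • S.ξ (f.ι p)) := by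
  have h : S.semisymmetric cov (FiberBundle.extend E (V p)) (f.ι p) (f.diff p v) =
      cov (FiberBundle.extend E (V p)) (f.ι p) (f.diff p v) +
        S.η (f.ι p) (V p) • f.diff p v - inner ℝ (V p) (f.diff p v) • S.ξ (f.ι p) := by
    rw [S.semisymmetric_apply, FiberBundle.extend_apply_self]
  rw [covAlong_apply, covAlong_apply, h]
  abel

lemma push_ξTangent (hf : f.Invariant S) : f.push (f.ξTangent S) = fun p ↦ S.ξ (f.ι p) :=
  funext fun p ↦ f.diff_tangentialPart (hf p).1

lemma diff_ξTangent (hf : f.Invariant S) (p : M) : f.diff p (f.ξTangent S p) = S.ξ (f.ι p) :=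
  f.diff_tangentialPart (hf p).1

lemma isSmoothField_ξTangent (hf : f.Invariant S) : IsSmoothField (f.ξTangent S) := by
  refine f.isSmoothField_of_push ?_
  rw [f.push_ξTangent hf]
  exact S.smooth_ξ.comp f.smooth

/-- On an invariant submanifold the semisymmetric connection has the same second fundamental
form. -/
lemma secondForm_semisymmetric (hf : f.Invariant S) :
    f.secondForm (S.semisymmetric cov) = f.secondForm cov := by
  funext p v w
  rw [secondForm, covAlong_semisymmetric, f.normalPart_add_of_mem]
  · rfl
  · exact Submodule.sub_mem _ (Submodule.smul_mem _ _ (f.diff_mem_tangentSubspace v))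
      (Submodule.smul_mem _ _ (hf p).1)

end Invariant

end ImmersedSubmanifold

/-! ### The derivative of `φ` along `ξ` -/

section AmbientXi

variable {E N : Type*} [NormedAddCommGroup E] [NormedSpace ℝ E] [FiniteDimensional ℝ E]
  [TopologicalSpace N] [ChartedSpace E N] [IsManifold 𝓘(ℝ, E) ∞ N]
  [RiemannianBundle (fun x : N ↦ TangentSpace 𝓘(ℝ, E) x)]
  {S : AlmostContactMetric E N}
  {cov : CovariantDerivative 𝓘(ℝ, E) E (fun x : N ↦ TangentSpace 𝓘(ℝ, E) x)}
  {β : N → ℝ}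

/-- On a normal manifold with `∇ξ = -β φ`, the derivative `∇_ξ φ` takes its values in the span
of `ξ`. -/
lemma AlmostContactMetric.IsSQSasakian.exists_cov_φ_sub (hS : S.IsSQSasakian cov β)
    (hcov : cov.torsion = 0) {W : (x : N) → TangentSpace 𝓘(ℝ, E) x} (hW : IsSmoothField W)
    (x : N) : ∃ c : ℝ, cov (fun y ↦ S.φ y (W y)) x (S.ξ x) - S.φ x (cov W x (S.ξ x)) =
      c • S.ξ x := by
  have hWd : DiffAlong E (fun y : N ↦ y) W x := hW.diffAlong x
  have hξd : DiffAlong E (fun y : N ↦ y) S.ξ x := IsSmoothField.diffAlong S.smooth_ξ x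
  have hφW : DiffAlong E (fun y : N ↦ y) (fun y ↦ S.φ y (W y)) x :=
    hWd.endField (b := fun y : N ↦ y) S.smooth_φ
  have h1 := cov.torsion_eq_zero_iff.1 hcov hWd hξd
  have h2 := cov.torsion_eq_zero_iff.1 hcov hφW hξd
  have hn := hS.normal W S.ξ hW S.smooth_ξ x
  have hz : (fun y ↦ S.φ y (S.ξ y)) = (0 : (y : N) → TangentSpace 𝓘(ℝ, E) y) :=
    funext S.φ_ξ
  rw [hz, mlieBracket_zero_right, mlieBracket_zero_right, ← h1, ← h2, hS.cov_ξ, hS.cov_ξ] at hn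
  -- Applying `φ` removes the `dη` term. The two contributions `β φ²W` from the brackets cancel, and
  -- the witness below is the `ξ`-component produced by `φ² = -id + η ⊗ ξ`.
  have hn' := congrArg (S.φ x) hn
  simp only [map_add, map_sub, map_neg, map_smul, S.φ_φ, S.φ_ξ, Pi.zero_apply, map_zero] at hn'
  refine ⟨S.η x (cov (fun y ↦ S.φ y (W y)) x (S.ξ x)), ?_⟩
  rw [← sub_eq_zero, ← neg_eq_zero]
  refine Eq.trans ?_ hn'
  module

end AmbientXi

/-! ### The second fundamental form in the direction of `ξ` -/

namespace ImmersedSubmanifold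

variable {E F N M : Type*} [NormedAddCommGroup E] [NormedSpace ℝ E] [FiniteDimensional ℝ E]
  [NormedAddCommGroup F] [NormedSpace ℝ F] [FiniteDimensional ℝ F]
  [TopologicalSpace N] [ChartedSpace E N] [IsManifold 𝓘(ℝ, E) ∞ N]
  [RiemannianBundle (fun x : N ↦ TangentSpace 𝓘(ℝ, E) x)]
  [TopologicalSpace M] [ChartedSpace F M] [IsManifold 𝓘(ℝ, F) ∞ M]
  {f : ImmersedSubmanifold E F N M} {S : AlmostContactMetric E N}
  {cov : CovariantDerivative 𝓘(ℝ, E) E (fun x : N ↦ TangentSpace 𝓘(ℝ, E) x)}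
  {β : N → ℝ} {p : M}

variable (f S) in
/-- The endomorphism `φ` restricted to an invariant submanifold. -/
noncomputable def φTangent (p : M) (v : TangentSpace 𝓘(ℝ, F) p) : TangentSpace 𝓘(ℝ, F) p :=
  f.tangentialPart p (S.φ (f.ι p) (f.diff p v))

lemma Invariant.diff_φTangent (hf : f.Invariant S) (v : TangentSpace 𝓘(ℝ, F) p) :
    f.diff p (f.φTangent S p v) = S.φ (f.ι p) (f.diff p v) :=
  f.diff_tangentialPart ((hf p).2 _ (f.diff_mem_tangentSubspace v))

lemma Invariant.φTangent_φTangent (hf : f.Invariant S) (v : TangentSpace 𝓘(ℝ, F) p) :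
    f.φTangent S p (f.φTangent S p v) = -v + S.η (f.ι p) (f.diff p v) • f.ξTangent S p := by
  refine f.immersive p ?_
  change f.diff p _ = f.diff p _
  rw [hf.diff_φTangent, hf.diff_φTangent, S.φ_φ, map_add, map_neg, map_smul, f.diff_ξTangent hf]

lemma covAlong_ξTangent (hS : S.IsSQSasakian cov β) (hf : f.Invariant S)
    (v : TangentSpace 𝓘(ℝ, F) p) :
    f.covAlong cov (f.push (f.ξTangent S)) p v =
      -(β (f.ι p) • S.φ (f.ι p) (f.diff p v)) := by
  rw [f.push_ξTangent hf, f.covAlong_comp cov (IsSmoothField.diffAlong S.smooth_ξ _), hS.cov_ξ]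

/-- The derivative `∇_v ξ = -β φv` is tangent by invariance. Thus everything below is needed only
modulo `ξ`. -/
lemma secondForm_ξTangent (hS : S.IsSQSasakian cov β) (hcov : cov.torsion = 0)
    (hf : f.Invariant S) (v : TangentSpace 𝓘(ℝ, F) p) :
    f.secondForm cov p v (f.ξTangent S p) = 0 := by
  rw [f.secondForm_eq hcov ((f.isSmoothField_ξTangent hf).diffAlong p), covAlong_ξTangent hS hf]
  refine f.normalPart_eq_zero (Submodule.neg_mem _ (Submodule.smul_mem _ _ ?_))
  exact (hf p).2 _ (f.diff_mem_tangentSubspace v)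

lemma secondForm_φTangent_φTangent (hS : S.IsSQSasakian cov β) (hcov : cov.torsion = 0)
    (hf : f.Invariant S) (v w : TangentSpace 𝓘(ℝ, F) p) :
    f.secondForm cov p v (f.φTangent S p (f.φTangent S p w)) = -f.secondForm cov p v w := by
  rw [hf.φTangent_φTangent, f.secondForm_add_right hcov, f.secondForm_smul_right hcov,
    secondForm_ξTangent hS hcov hf, smul_zero, add_zero, ← neg_one_smul ℝ w,
    f.secondForm_smul_right hcov, neg_one_smul]

/-- If `a h(v, w) = b h(v, φ w)` for all `w`, then `(a² + b²) h = 0`. -/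
lemma secondForm_eq_zero_of_φTangent (hS : S.IsSQSasakian cov β) (hcov : cov.torsion = 0)
    (hf : f.Invariant S) {a b : ℝ} (hab : a ^ 2 + b ^ 2 ≠ 0) {v : TangentSpace 𝓘(ℝ, F) p}
    (h : ∀ w, a • f.secondForm cov p v w = b • f.secondForm cov p v (f.φTangent S p w))
    (w : TangentSpace 𝓘(ℝ, F) p) : f.secondForm cov p v w = 0 := by
  -- Using the hypothesis again at `φw` gives `a h(v, φw) = -b h(v, w)`, so `a² h = b (a h(v, φw)) =
  -- -b² h`.
  have h1 := h (f.φTangent S p w)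
  rw [secondForm_φTangent_φTangent hS hcov hf] at h1
  have h2 : (a ^ 2 + b ^ 2) • f.secondForm cov p v w = 0 := by
    rw [add_smul, pow_two, mul_smul, h w, smul_comm, h1]
    module
  exact (smul_eq_zero.1 h2).resolve_left hab

/-- The semisymmetric derivative of `ξ`, as a field along the submanifold. -/
lemma covAlong_semisymmetric_ξTangent (hS : S.IsSQSasakian cov β) (hf : f.Invariant S)
    (v : TangentSpace 𝓘(ℝ, F) p) :
    f.covAlong (S.semisymmetric cov) (f.push (f.ξTangent S)) p v =
      f.diff p v + -(β (f.ι p)) • S.φ (f.ι p) (f.diff p v)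
        + -(S.η (f.ι p) (f.diff p v)) • S.ξ (f.ι p) := by
  have e : f.push (f.ξTangent S) p = S.ξ (f.ι p) := f.diff_ξTangent hf p
  rw [covAlong_semisymmetric, covAlong_ξTangent hS hf, e, S.η_ξ, real_inner_comm, S.inner_ξ]
  module

lemma diff_inducedCov_ξTangent (hS : S.IsSQSasakian cov β) (hf : f.Invariant S)
    (X : (p : M) → TangentSpace 𝓘(ℝ, F) p) (p : M) :
    f.diff p (f.inducedCov (S.semisymmetric cov) X (f.ξTangent S) p) =
      f.push X p + -(β (f.ι p)) • S.φ (f.ι p) (f.push X p)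
        + -(S.η (f.ι p) (f.push X p)) • S.ξ (f.ι p) := by
  rw [inducedCov, covAlong_semisymmetric_ξTangent hS hf]
  refine f.diff_tangentialPart ?_
  exact Submodule.add_mem _ (Submodule.add_mem _ (f.diff_mem_tangentSubspace _)
    (Submodule.smul_mem _ _ ((hf p).2 _ (f.diff_mem_tangentSubspace _))))
    (Submodule.smul_mem _ _ (hf p).1)

lemma inducedCov_ξTangent (hS : S.IsSQSasakian cov β) (hf : f.Invariant S)
    (X : (p : M) → TangentSpace 𝓘(ℝ, F) p) (p : M) :
    f.inducedCov (S.semisymmetric cov) X (f.ξTangent S) p =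
      X p + -(β (f.ι p)) • f.φTangent S p (X p)
        + -(S.η (f.ι p) (f.diff p (X p))) • f.ξTangent S p := by
  refine f.immersive p ((diff_inducedCov_ξTangent hS hf X p).trans ?_)
  change _ = f.diff p _
  simp only [map_add, map_smul, hf.diff_φTangent, f.diff_ξTangent hf, push]

lemma secondForm_inducedCov_ξTangent (hS : S.IsSQSasakian cov β) (hcov : cov.torsion = 0)
    (hf : f.Invariant S) (X : (p : M) → TangentSpace 𝓘(ℝ, F) p) (v : TangentSpace 𝓘(ℝ, F) p) :
    f.secondForm cov p v (f.inducedCov (S.semisymmetric cov) X (f.ξTangent S) p) =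
      f.secondForm cov p v (X p) - β (f.ι p) • f.secondForm cov p v (f.φTangent S p (X p)) := by
  rw [inducedCov_ξTangent hS hf]
  simp only [f.secondForm_add_right hcov, f.secondForm_smul_right hcov,
    secondForm_ξTangent hS hcov hf]
  module

lemma covAlong_zero (cov : CovariantDerivative 𝓘(ℝ, E) E (fun x : N ↦ TangentSpace 𝓘(ℝ, E) x))
    (v : TangentSpace 𝓘(ℝ, F) p) : f.covAlong cov (fun _ ↦ 0) p v = 0 := by
  have h0 : DiffAlong F f.ι (fun q ↦ (0 : TangentSpace 𝓘(ℝ, E) (f.ι q))) p :=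
    DiffAlong.comp (Z := fun x : N ↦ (0 : TangentSpace 𝓘(ℝ, E) x))
      (mdifferentiableAt_zeroSection ℝ (fun x : N ↦ TangentSpace 𝓘(ℝ, E) x))
      (f.mdifferentiableAt_ι p)
  have h := f.covAlong_add cov h0 h0 v
  simp only [add_zero] at h
  simpa using h

lemma normalCov_zero (cov : CovariantDerivative 𝓘(ℝ, E) E (fun x : N ↦ TangentSpace 𝓘(ℝ, E) x))
    (X : (p : M) → TangentSpace 𝓘(ℝ, F) p) : f.normalCov cov X (fun _ ↦ 0) = fun _ ↦ 0 := by
  funext q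
  rw [normalCov, covAlong_zero, f.normalPart_eq_zero (Submodule.zero_mem _)]

/-- The derivative `(∇_X h)(Y, ξ)` of the second fundamental form, for the semisymmetric
connection. -/
lemma covSecondForm_ξTangent (hS : S.IsSQSasakian cov β) (hcov : cov.torsion = 0)
    (hf : f.Invariant S) (X Y : (p : M) → TangentSpace 𝓘(ℝ, F) p) (p : M) :
    f.covSecondForm (S.semisymmetric cov) X Y (f.ξTangent S) p =
      β (f.ι p) • f.secondForm cov p (Y p) (f.φTangent S p (X p)) -
        f.secondForm cov p (Y p) (X p) := by
  simp only [covSecondForm, normalCov, f.secondForm_semisymmetric hf,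
    secondForm_ξTangent hS hcov hf, secondForm_inducedCov_ξTangent hS hcov hf, covAlong_zero]
  rw [f.normalPart_eq_zero (Submodule.zero_mem _)]
  abel

/-- The other two terms contain `h(·, ξ)`, which vanishes identically as a field and so has zero
normal curvature. -/
lemma curvatureDotSecondForm_ξTangent (hS : S.IsSQSasakian cov β) (hcov : cov.torsion = 0)
    (hf : f.Invariant S) (X Y Z : (p : M) → TangentSpace 𝓘(ℝ, F) p) (p : M) :
    f.curvatureDotSecondForm (S.semisymmetric cov) X Y Z (f.ξTangent S) p =
      -f.secondForm cov p (Z p) (f.curvature (S.semisymmetric cov) X Y (f.ξTangent S) p) := by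
  simp only [curvatureDotSecondForm, normalCurvature, f.secondForm_semisymmetric hf,
    secondForm_ξTangent hS hcov hf, normalCov_zero]
  simp

end ImmersedSubmanifold

/-! ### The curvature `R̃(X, ξ)ξ` -/

namespace ImmersedSubmanifold

variable {E F N M : Type*} [NormedAddCommGroup E] [NormedSpace ℝ E] [FiniteDimensional ℝ E]
  [NormedAddCommGroup F] [NormedSpace ℝ F] [FiniteDimensional ℝ F]
  [TopologicalSpace N] [T2Space N] [ChartedSpace E N] [IsManifold 𝓘(ℝ, E) ∞ N]
  [RiemannianBundle (fun x : N ↦ TangentSpace 𝓘(ℝ, E) x)]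
  [IsContMDiffRiemannianBundle 𝓘(ℝ, E) ∞ E (fun x : N ↦ TangentSpace 𝓘(ℝ, E) x)]
  [TopologicalSpace M] [ChartedSpace F M] [IsManifold 𝓘(ℝ, F) ∞ M]
  {f : ImmersedSubmanifold E F N M} {S : AlmostContactMetric E N}
  {cov : CovariantDerivative 𝓘(ℝ, E) E (fun x : N ↦ TangentSpace 𝓘(ℝ, E) x)}
  {β : N → ℝ}

/-- The derivative along `ξ` of the field `∇̃_X ξ`. -/
lemma exists_covAlong_inducedCov_ξTangent (hS : S.IsSQSasakian cov β) (hcov : cov.torsion = 0)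
    (hf : f.Invariant S) {X : (p : M) → TangentSpace 𝓘(ℝ, F) p} (hX : IsSmoothField X) (p : M) :
    ∃ k : ℝ, f.covAlong (S.semisymmetric cov)
        (f.push (f.inducedCov (S.semisymmetric cov) X (f.ξTangent S))) p (f.ξTangent S p) =
      f.covAlong cov (f.push X) p (f.ξTangent S p)
        + -(β (f.ι p)) • S.φ (f.ι p) (f.covAlong cov (f.push X) p (f.ξTangent S p))
        + k • S.ξ (f.ι p) := by
  have hpush : f.push (f.inducedCov (S.semisymmetric cov) X (f.ξTangent S)) =
      fun q ↦ f.push X q + -(β (f.ι q)) • S.φ (f.ι q) (f.push X q)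
        + -(S.η (f.ι q) (f.push X q)) • S.ξ (f.ι q) :=
    funext fun q ↦ diff_inducedCov_ξTangent hS hf X q
  have hVX : DiffAlong F f.ι (f.push X) p := f.diffAlong_push (hX.diffAlong p)
  have hVφ : DiffAlong F f.ι (fun q ↦ S.φ (f.ι q) (f.push X q)) p := hVX.endField S.smooth_φ
  have hVξ : DiffAlong F f.ι (fun q ↦ S.ξ (f.ι q)) p :=
    DiffAlong.comp (IsSmoothField.diffAlong S.smooth_ξ _) (f.mdifferentiableAt_ι p)
  have hβ : MDifferentiableAt 𝓘(ℝ, E) 𝓘(ℝ, ℝ) β (f.ι p) :=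
    (hS.smooth_β _).mdifferentiableAt (by simp)
  have hβ' : MDifferentiableAt 𝓘(ℝ, F) 𝓘(ℝ, ℝ) (fun q ↦ -β (f.ι q)) p :=
    (hβ.comp p (f.mdifferentiableAt_ι p)).neg
  have hη : MDifferentiableAt 𝓘(ℝ, F) 𝓘(ℝ, ℝ) (fun q ↦ -S.η (f.ι q) (f.push X q)) p := by
    -- Differentiability of `η(X)` is read off from `η = g(·, ξ)`.
    have h := MDifferentiableAt.inner_bundle (E := fun x : N ↦ TangentSpace 𝓘(ℝ, E) x)
      (IB := 𝓘(ℝ, E)) hVX hVξ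
    simp only [S.inner_ξ] at h
    exact h.neg
  have hdβ : mvfderiv 𝓘(ℝ, F) (fun q ↦ -β (f.ι q)) p (f.ξTangent S p) = 0 := by
    have h1 : mvfderiv 𝓘(ℝ, F) (fun q ↦ β (f.ι q)) p (f.ξTangent S p) =
        mvfderiv 𝓘(ℝ, E) β (f.ι p) (f.diff p (f.ξTangent S p)) :=
      mvfderiv_comp_apply p hβ (f.mdifferentiableAt_ι p) (f.ξTangent S p)
    rw [f.diff_ξTangent hf, hS.ξ_β] at h1
    have h2 := mvfderiv_neg (I := 𝓘(ℝ, F)) (g := fun q ↦ β (f.ι q)) (x := p)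
    have h3 := congrArg (fun L ↦ L (f.ξTangent S p)) h2
    refine h3.trans ?_
    change -(mvfderiv 𝓘(ℝ, F) (fun q ↦ β (f.ι q)) p (f.ξTangent S p)) = 0
    rw [h1, neg_zero]
  -- The statement about `∇_ξ φ` concerns ambient fields; by tensoriality any `W` with the value of
  -- `X` at `p` serves.
  obtain ⟨W, hW, hWp⟩ := exists_isSmoothField (f.push X p)
  obtain ⟨c, hc⟩ := hS.exists_cov_φ_sub hcov hW (f.ι p)
  have hφ := f.covAlong_endField cov S.smooth_φ hVX (hW.diffAlong _) hWp (f.ξTangent S p)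
  rw [f.diff_ξTangent hf, add_sub_assoc, hc] at hφ
  have hξ : f.covAlong cov (fun q ↦ S.ξ (f.ι q)) p (f.ξTangent S p) = 0 := by
    rw [← f.push_ξTangent hf, covAlong_ξTangent hS hf, f.diff_ξTangent hf, S.φ_ξ, smul_zero,
      neg_zero]
  -- In the direction `ξ` the semisymmetric correction is `η(V) ξ - g(V, ξ) ξ = 0`, so only the
  -- Levi-Civita derivative remains.
  rw [covAlong_semisymmetric, f.diff_ξTangent hf, S.inner_ξ, sub_self, add_zero, hpush,
    f.covAlong_add cov (hVX.add (hVφ.smul hβ')) (hVξ.smul hη),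
    f.covAlong_add cov hVX (hVφ.smul hβ'), f.covAlong_smul cov hβ' hVφ,
    f.covAlong_smul cov hη hVξ, hφ, hξ, hdβ]
  exact ⟨-β (f.ι p) * c + mvfderiv 𝓘(ℝ, F) (fun q ↦ -S.η (f.ι q) (f.push X q)) p
    (f.ξTangent S p), by module⟩

/-- The curvature `R̃(X, ξ)ξ` of the connection induced by the semisymmetric connection. -/
lemma exists_curvature_ξTangent (hS : S.IsSQSasakian cov β) (hcov : cov.torsion = 0)
    (hf : f.Invariant S) {X : (p : M) → TangentSpace 𝓘(ℝ, F) p} (hX : IsSmoothField X) (p : M) :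
    ∃ k : ℝ, f.curvature (S.semisymmetric cov) X (f.ξTangent S) (f.ξTangent S) p =
      β (f.ι p) • f.φTangent S p (X p) + β (f.ι p) ^ 2 • X p + k • f.ξTangent S p := by
  obtain ⟨k, hk⟩ := exists_covAlong_inducedCov_ξTangent hS hcov hf hX p
  -- Here `∇̃_ξ ξ = ξ - β φξ - η(ξ) ξ = 0`, which removes the first term of the curvature.
  have h0 : f.inducedCov (S.semisymmetric cov) (f.ξTangent S) (f.ξTangent S) = fun _ ↦ 0 := by
    funext q
    refine f.immersive q ((diff_inducedCov_ξTangent hS hf _ q).trans ?_)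
    rw [f.push_ξTangent hf, S.φ_ξ, S.η_ξ]
    change _ = f.diff q 0
    rw [map_zero]
    module
  have h1 : f.inducedCov (S.semisymmetric cov) X (fun _ ↦ 0) p = 0 := by
    have : f.push (fun q ↦ (0 : TangentSpace 𝓘(ℝ, F) q)) = fun _ ↦ 0 :=
      funext fun q ↦ map_zero (f.diff q)
    rw [inducedCov, this, covAlong_zero]
    refine f.immersive p ((f.diff_tangentialPart (Submodule.zero_mem _)).trans ?_)
    exact (map_zero (f.diff p)).symm
  have h2 := f.covAlong_push_sub hcov (hX.diffAlong p) ((f.isSmoothField_ξTangent hf).diffAlong p)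
  rw [covAlong_ξTangent hS hf] at h2
  have h3 := diff_inducedCov_ξTangent hS hf (mlieBracket 𝓘(ℝ, F) X (f.ξTangent S)) p
  have h4 : f.push (mlieBracket 𝓘(ℝ, F) X (f.ξTangent S)) p =
    f.diff p (mlieBracket 𝓘(ℝ, F) X (f.ξTangent S) p) := rfl
  -- Vanishing torsion gives `∇_ξ X = -β φX - [X, ξ]`, a sum of tangent vectors.
  have ha : f.covAlong cov (f.push X) p (f.ξTangent S p) ∈ f.tangentSubspace p := by
    rw [show f.covAlong cov (f.push X) p (f.ξTangent S p) =
      f.diff p (-(β (f.ι p) • f.φTangent S p (X p)) - mlieBracket 𝓘(ℝ, F) X (f.ξTangent S) p) by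
        rw [map_sub, map_neg, map_smul, hf.diff_φTangent, ← h2]; abel]
    exact f.diff_mem_tangentSubspace _
  have h5 : f.diff p (f.inducedCov (S.semisymmetric cov) (f.ξTangent S)
      (f.inducedCov (S.semisymmetric cov) X (f.ξTangent S)) p) =
      f.covAlong cov (f.push X) p (f.ξTangent S p)
        + -(β (f.ι p)) • S.φ (f.ι p) (f.covAlong cov (f.push X) p (f.ξTangent S p))
        + k • S.ξ (f.ι p) := by
    rw [inducedCov, hk]
    exact f.diff_tangentialPart (Submodule.add_mem _ (Submodule.add_mem _ ha
      (Submodule.smul_mem _ _ ((hf p).2 _ ha))) (Submodule.smul_mem _ _ (hf p).1))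
  -- The three summands are the `ξ`-components of `-∇̃_ξ ∇̃_X ξ`, of `-∇̃_[X,ξ] ξ` and of `-β² φ²X`.
  -- The terms in `∇_ξ X` cancel once `[X, ξ]` is replaced by `-β φX - ∇_ξ X`.
  refine ⟨-k + S.η (f.ι p) (f.diff p (mlieBracket 𝓘(ℝ, F) X (f.ξTangent S) p))
    - β (f.ι p) ^ 2 * S.η (f.ι p) (f.push X p), f.immersive p ?_⟩
  change f.diff p _ = f.diff p _
  rw [curvature, h0, h1, zero_sub, map_sub, map_neg, h5, h3, h4, ← h2]
  simp only [map_add, map_sub, map_neg, map_smul, hf.diff_φTangent, f.diff_ξTangent hf, S.φ_φ,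
    push]
  module

lemma secondForm_curvature_ξTangent (hS : S.IsSQSasakian cov β) (hcov : cov.torsion = 0)
    (hf : f.Invariant S) {X : (p : M) → TangentSpace 𝓘(ℝ, F) p} (hX : IsSmoothField X) {p : M}
    (v : TangentSpace 𝓘(ℝ, F) p) :
    f.secondForm cov p v
        (f.curvature (S.semisymmetric cov) X (f.ξTangent S) (f.ξTangent S) p) =
      β (f.ι p) • f.secondForm cov p v (f.φTangent S p (X p)) +
        β (f.ι p) ^ 2 • f.secondForm cov p v (X p) := by
  obtain ⟨k, hk⟩ := exists_curvature_ξTangent hS hcov hf hX p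
  rw [hk]
  simp only [f.secondForm_add_right hcov, f.secondForm_smul_right hcov,
    secondForm_ξTangent hS hcov hf, smul_zero, add_zero]

end ImmersedSubmanifold

/-! ### From the parallelism conditions to `h = 0`, and back -/

namespace ImmersedSubmanifold

variable {E F N M : Type*}
  [NormedAddCommGroup E] [NormedSpace ℝ E] [FiniteDimensional ℝ E]
  [NormedAddCommGroup F] [NormedSpace ℝ F] [FiniteDimensional ℝ F]
  [TopologicalSpace N] [ChartedSpace E N] [IsManifold 𝓘(ℝ, E) ∞ N]
  [RiemannianBundle (fun x : N ↦ TangentSpace 𝓘(ℝ, E) x)]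
  [TopologicalSpace M] [ChartedSpace F M] [IsManifold 𝓘(ℝ, F) ∞ M]
  {S : AlmostContactMetric E N}
  {cov : CovariantDerivative 𝓘(ℝ, E) E (fun x : N ↦ TangentSpace 𝓘(ℝ, E) x)}
  {β : N → ℝ} {f : ImmersedSubmanifold E F N M} {p : M}

section Vanishing

variable {D : CovariantDerivative 𝓘(ℝ, E) E (fun x : N ↦ TangentSpace 𝓘(ℝ, E) x)}

lemma TotallyGeodesic.secondForm_eq (h : f.TotallyGeodesic D) :
    f.secondForm D = fun _ _ _ ↦ 0 := by
  funext p v w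
  exact h p v w

lemma TotallyGeodesic.covSecondForm_eq_zero (h : f.TotallyGeodesic D)
    (X Y Z : (p : M) → TangentSpace 𝓘(ℝ, F) p) (p : M) : f.covSecondForm D X Y Z p = 0 := by
  simp only [covSecondForm, h.secondForm_eq, normalCov_zero, sub_zero]

lemma TotallyGeodesic.curvatureDotSecondForm_eq_zero (h : f.TotallyGeodesic D)
    (X Y Z U : (p : M) → TangentSpace 𝓘(ℝ, F) p) (p : M) :
    f.curvatureDotSecondForm D X Y Z U p = 0 := by
  simp only [curvatureDotSecondForm, normalCurvature, h.secondForm_eq, normalCov_zero, sub_zero]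

lemma TotallyGeodesic.nonUmbilical_eq_empty (h : f.TotallyGeodesic D) :
    f.nonUmbilical D = ∅ := by
  refine Set.eq_empty_of_forall_notMem fun p hp ↦ hp fun v w ↦ ?_
  simp [meanCurvature, h.secondForm_eq]

end Vanishing

lemma metric_ξTangent_self (hf : f.Invariant S) (p : M) :
    f.metric p (f.ξTangent S p) (f.ξTangent S p) = 1 := by
  rw [metric, f.diff_ξTangent hf, S.inner_ξ, S.η_ξ]

/-- At its umbilical points an invariant submanifold has vanishing second fundamental form. -/
lemma secondForm_eq_zero_of_notMem_nonUmbilical (hS : S.IsSQSasakian cov β)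
    (hcov : cov.torsion = 0) (hf : f.Invariant S) (hp : p ∉ f.nonUmbilical (S.semisymmetric cov))
    (v w : TangentSpace 𝓘(ℝ, F) p) : f.secondForm cov p v w = 0 := by
  have hu : ∀ v w : TangentSpace 𝓘(ℝ, F) p, f.secondForm (S.semisymmetric cov) p v w -
      f.metric p v w • f.meanCurvature (S.semisymmetric cov) p = 0 := not_not.1 hp
  rw [f.secondForm_semisymmetric hf] at hu
  -- Umbilicity on `(ξ, ξ)` reads `0 = H`.
  have hH := hu (f.ξTangent S p) (f.ξTangent S p)
  rw [secondForm_ξTangent hS hcov hf, metric_ξTangent_self hf, one_smul, zero_sub,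
    neg_eq_zero] at hH
  have h := hu v w
  rwa [hH, smul_zero, sub_zero] at h

lemma totallyGeodesic_semisymmetric_iff (hf : f.Invariant S) :
    f.TotallyGeodesic (S.semisymmetric cov) ↔ f.TotallyGeodesic cov := by
  rw [TotallyGeodesic, TotallyGeodesic, f.secondForm_semisymmetric hf]

/-- Only the term with coefficient `g(ξ, ξ) = 1` is free of `ξ` inside `h`. -/
lemma tachibana_ξTangent (hS : S.IsSQSasakian cov β) (hcov : cov.torsion = 0)
    (hf : f.Invariant S) (X Z : (p : M) → TangentSpace 𝓘(ℝ, F) p) (p : M) :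
    f.tachibana (S.semisymmetric cov) X (f.ξTangent S) Z (f.ξTangent S) p =
      f.secondForm cov p (Z p) (X p) := by
  have h : f.secondForm cov p (f.ξTangent S p) (Z p) = 0 := by
    rw [f.secondForm_symm hcov, secondForm_ξTangent hS hcov hf]
  simp only [tachibana, f.secondForm_semisymmetric hf, secondForm_ξTangent hS hcov hf,
    metric_ξTangent_self hf, h, f.secondForm_symm hcov (X p) (Z p)]
  module

section ParallelConditions

variable [T2Space M]

/-- With `Z = ξ` only the `α(Z)` term survives on the right, giving the key identity with `a = α(ξ)
+ 1` and `b = β`. -/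
lemma ChakiPseudoParallel.totallyGeodesic (hS : S.IsSQSasakian cov β) (hcov : cov.torsion = 0)
    (hf : f.Invariant S) {α : (p : M) → TangentSpace 𝓘(ℝ, F) p →L[ℝ] ℝ}
    (h : f.ChakiPseudoParallel (S.semisymmetric cov) α)
    (hα : ∀ p, (α p (f.ξTangent S p) + 1) ^ 2 + β (f.ι p) ^ 2 ≠ 0) :
    f.TotallyGeodesic cov := by
  intro p v w
  refine secondForm_eq_zero_of_φTangent hS hcov hf (hα p) (fun w ↦ ?_) w
  obtain ⟨X, hX, rfl⟩ := exists_isSmoothField w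
  obtain ⟨Y, hY, rfl⟩ := exists_isSmoothField v
  have h1 := h X Y (f.ξTangent S) hX hY (f.isSmoothField_ξTangent hf) p
  rw [covSecondForm_ξTangent hS hcov hf, f.secondForm_semisymmetric hf,
    secondForm_ξTangent hS hcov hf, secondForm_ξTangent hS hcov hf, smul_zero, smul_zero,
    zero_add, zero_add, f.secondForm_symm hcov (X p) (Y p), sub_eq_iff_eq_add] at h1
  rw [h1]
  module

lemma Parallel.totallyGeodesic (hS : S.IsSQSasakian cov β) (hcov : cov.torsion = 0)
    (hf : f.Invariant S) (h : f.Parallel (S.semisymmetric cov)) : f.TotallyGeodesic cov := by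
  -- For `α = 0` the non-degeneracy is `1 + β² ≠ 0`, which is automatic.
  refine ChakiPseudoParallel.totallyGeodesic hS hcov hf (α := fun _ ↦ 0)
    (fun X Y Z hX hY hZ p ↦ ?_) fun p ↦ ?_
  · rw [h X Y Z hX hY hZ p]
    simp
  · change ((0 : ℝ) + 1) ^ 2 + _ ≠ 0
    positivity

variable [T2Space N] [IsContMDiffRiemannianBundle 𝓘(ℝ, E) ∞ E
  (fun x : N ↦ TangentSpace 𝓘(ℝ, E) x)]

lemma DeszczPseudoParallel.totallyGeodesic (hS : S.IsSQSasakian cov β) (hcov : cov.torsion = 0)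
    (hf : f.Invariant S) {L : M → ℝ} (h : f.DeszczPseudoParallel (S.semisymmetric cov) L)
    (hL : ∀ p ∈ f.nonUmbilical (S.semisymmetric cov),
      (L p + β (f.ι p) ^ 2) ^ 2 + β (f.ι p) ^ 2 ≠ 0) :
    f.TotallyGeodesic cov := by
  intro p v w
  by_cases hp : p ∈ f.nonUmbilical (S.semisymmetric cov)
  swap
  · exact secondForm_eq_zero_of_notMem_nonUmbilical hS hcov hf hp v w
  -- These coefficients come from `Y = U = ξ`, where the condition reads `-(β h(Z, φX) + β² h(Z, X))
  -- = L h(Z, X)`.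
  refine secondForm_eq_zero_of_φTangent hS hcov hf (a := L p + β (f.ι p) ^ 2) (b := -β (f.ι p))
    (by rw [neg_sq]; exact hL p hp) (fun w ↦ ?_) w
  obtain ⟨X, hX, rfl⟩ := exists_isSmoothField w
  obtain ⟨Z, hZ, rfl⟩ := exists_isSmoothField v
  have hξ := f.isSmoothField_ξTangent hf
  have h1 := h X (f.ξTangent S) Z (f.ξTangent S) hX hξ hZ hξ p hp
  rw [curvatureDotSecondForm_ξTangent hS hcov hf, secondForm_curvature_ξTangent hS hcov hf hX,
    tachibana_ξTangent hS hcov hf] at h1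
  rw [add_smul, ← h1]
  module

lemma Semiparallel.totallyGeodesic (hS : S.IsSQSasakian cov β) (hcov : cov.torsion = 0)
    (hf : f.Invariant S) (h : f.Semiparallel (S.semisymmetric cov))
    (hβ : ∀ p ∈ f.nonUmbilical (S.semisymmetric cov), β (f.ι p) ^ 2 * (β (f.ι p) ^ 2 + 1) ≠ 0) :
    f.TotallyGeodesic cov := by
  -- For `L = 0` the quantity `(L + β²)² + β²` is `β² (β² + 1)`.
  refine DeszczPseudoParallel.totallyGeodesic hS hcov hf (L := fun _ ↦ 0)
    (fun X Y Z U hX hY hZ hU p _ ↦ ?_) fun p hp ↦ ?_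
  · rw [h X Y Z U hX hY hZ hU p, zero_smul]
  · convert hβ p hp using 1
    ring

end ParallelConditions

end ImmersedSubmanifold

end Preliminaries

theorem theorem3p7
    {E F N M : Type*}
    [NormedAddCommGroup E] [NormedSpace ℝ E] [FiniteDimensional ℝ E]
    [NormedAddCommGroup F] [NormedSpace ℝ F] [FiniteDimensional ℝ F]
    [TopologicalSpace N] [T2Space N] [ChartedSpace E N] [IsManifold 𝓘(ℝ, E) ∞ N]
    [RiemannianBundle (fun x : N ↦ TangentSpace 𝓘(ℝ, E) x)]
    [IsContMDiffRiemannianBundle 𝓘(ℝ, E) ∞ E (fun x : N ↦ TangentSpace 𝓘(ℝ, E) x)]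
    [TopologicalSpace M] [T2Space M] [ChartedSpace F M] [IsManifold 𝓘(ℝ, F) ∞ M]
    (S : AlmostContactMetric E N)
    (cov : CovariantDerivative 𝓘(ℝ, E) E (fun x : N ↦ TangentSpace 𝓘(ℝ, E) x))
    (hcov : IsLeviCivita cov)
    (β : N → ℝ) (hS : S.IsSQSasakian cov β)
    (f : ImmersedSubmanifold E F N M) (hf : f.Invariant S) :
    [ f.TotallyGeodesic cov,
      f.Parallel (S.semisymmetric cov),
      f.Semiparallel (S.semisymmetric cov) ∧
        ∀ p ∈ f.nonUmbilical (S.semisymmetric cov), β (f.ι p) ^ 2 * (β (f.ι p) ^ 2 + 1) ≠ 0,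
      ∃ α : (p : M) → TangentSpace 𝓘(ℝ, F) p →L[ℝ] ℝ, IsSmoothOneForm α ∧
        f.ChakiPseudoParallel (S.semisymmetric cov) α ∧
        ∀ p, (α p (f.ξTangent S p) + 1) ^ 2 + β (f.ι p) ^ 2 ≠ 0,
      ∃ α : (p : M) → TangentSpace 𝓘(ℝ, F) p →L[ℝ] ℝ, IsSmoothOneForm α ∧ (∀ p, α p ≠ 0) ∧
        f.ChakiPseudoParallel (S.semisymmetric cov) α ∧
        ∀ p, (α p (f.ξTangent S p) + 1) ^ 2 + β (f.ι p) ^ 2 ≠ 0,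
      ∃ L : M → ℝ, f.DeszczPseudoParallel (S.semisymmetric cov) L ∧
        ∀ p ∈ f.nonUmbilical (S.semisymmetric cov),
          (L p + β (f.ι p) ^ 2) ^ 2 + β (f.ι p) ^ 2 ≠ 0 ].TFAE ∧
    ((∀ p, β (f.ι p) ≠ 0) →
      (f.TotallyGeodesic cov ↔ f.Semiparallel (S.semisymmetric cov))) := by
  have ht := hcov.torsion_free
  have h13 (h : f.TotallyGeodesic cov) : f.Semiparallel (S.semisymmetric cov) :=
    fun X Y Z U _ _ _ _ p ↦ ((ImmersedSubmanifold.totallyGeodesic_semisymmetric_iff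
      hf).2 h).curvatureDotSecondForm_eq_zero X Y Z U p
  have hW (h : f.TotallyGeodesic cov) : f.nonUmbilical (S.semisymmetric cov) = ∅ :=
    ((ImmersedSubmanifold.totallyGeodesic_semisymmetric_iff hf).2 h).nonUmbilical_eq_empty
  refine ⟨?_, fun hβ ↦ ⟨h13, fun h ↦ h.totallyGeodesic hS ht hf fun p _ ↦ ?_⟩⟩
  swap
  · have := hβ p
    positivity
  tfae_have 1 → 2 := fun h X Y Z _ _ _ p ↦
    ((ImmersedSubmanifold.totallyGeodesic_semisymmetric_iff hf).2 h).covSecondForm_eq_zero X Y Z p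
  tfae_have 2 → 1 := fun h ↦ h.totallyGeodesic hS ht hf
  tfae_have 1 → 3 := fun h ↦ ⟨h13 h, by simp [hW h]⟩
  tfae_have 3 → 1 := fun h ↦ h.1.totallyGeodesic hS ht hf h.2
  tfae_have 1 → 5 := by
    intro h
    have h' := (ImmersedSubmanifold.totallyGeodesic_semisymmetric_iff hf).2 h
    have h1 (p : M) : S.η (f.ι p) (f.diff p (f.ξTangent S p)) = 1 := by
      rw [f.diff_ξTangent hf, S.η_ξ]
    -- The pullback of `η` takes the value `1` on `ξ`, so it vanishes nowhere and `(α(ξ) + 1)² + β²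
    -- = 4 + β² > 0`.
    refine ⟨fun p ↦ (S.η (f.ι p)).comp (f.diff p), f.isSmoothOneForm_comp_diff S.smooth_η,
      fun p h0 ↦ ?_, fun X Y Z _ _ _ p ↦ ?_, fun p ↦ ?_⟩
    · have h2 : S.η (f.ι p) (f.diff p (f.ξTangent S p)) = 0 :=
        DFunLike.congr_fun h0 (f.ξTangent S p)
      exact one_ne_zero ((h1 p).symm.trans h2)
    · rw [h'.covSecondForm_eq_zero, h'.secondForm_eq]
      simp
    · change (S.η (f.ι p) (f.diff p (f.ξTangent S p)) + 1) ^ 2 + _ ≠ 0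
      rw [h1]
      positivity
  tfae_have 5 → 4 := fun ⟨α, hα, _, h⟩ ↦ ⟨α, hα, h⟩
  tfae_have 4 → 1 := fun ⟨_, _, h, hα⟩ ↦ h.totallyGeodesic hS ht hf hα
  -- As `W` is empty, any function would do.
  tfae_have 1 → 6 := fun h ↦ ⟨fun _ ↦ 0, fun _ _ _ _ _ _ _ _ p hp ↦ by simp [hW h] at hp,
    by simp [hW h]⟩
  tfae_have 6 → 1 := fun ⟨_, h, hL⟩ ↦ h.totallyGeodesic hS ht hf hL
  tfae_finish
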